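/- **Pullbacks and cells.** All fibre products of categories below are strict pullbacks (pullbacks in the 1-category of categories). A *not necessarily fibrant bicategory object in $\mathrm{CAT}$* consists of the following. *0-data.* Categories $C_0,C_1,C_2$ and functors $s,t\colon C_1\to C_0$, $s,t\colon C_2\to C_1$ with $st=ss$ and $tt=ts$. *1-data.* Nine functors, compatible with $s$ and $t$ in the way indicated by the notation; they are written on generalized elements $u,v,w$ of $C_1$ and $x,y$ of $C_2$, and all compositions are in diagrammatic order: the horizontal identity $i\colon C_0\to C_1$; horizontal composition $m\colon C_1\times_{C_0}C_1\to C_1$, written $uv$; the vertical identity $C_1\to C_2$, $1_u\colon u\to u$; vertical composition $m_v\colon C_2\times_{C_1}C_2\to C_2$, written $x\cdot y$; the right whisker $w_r\colon C_2\times_{C_0}C_1\to C_2$, $x\triangleright v\colon uv\to u'v$ for $x\colon u\to u'$; the left whisker $w_l\colon C_1\times_{C_0}C_2\to C_2$, $u\triangleleft y\colon uv\to uv'$ for $y\colon v\to v'$; the left identity $l_u\colon iu\to u$; the right identity $r_u\colon ui\to u$; and the associator $a_{u,v,w}\colon (uv)w\to u(vw)$ on $C_1\times_{C_0}C_1\times_{C_0}C_1$.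 (Here $x\colon u\to u'$ means that $x$ lies in $C_2$ and $s(x)=u$, $t(x)=u'$.) The functors $l,r,a$ are required to be *invertible*: each of them has a two-sided inverse for vertical composition, up to natural isomorphisms which $s$ and $t$ send to identities and which satisfy the two triangle identities. *2-data.* Eighteen natural isomorphisms between functors with values in $C_2$ which $s$ and $t$ send to identity transformations: $\lambda_x\colon 1_u\cdot x\Rightarrow x$; $\rho_x\colon x\cdot 1_v\Rightarrow x$; $\alpha_{x,y,z}\colon (x\cdot y)\cdot z\Rightarrow x\cdot(y\cdot z)$; $e^R_{u,v}\colon 1_u\triangleright v\Rightarrow 1_{uv}$; $e^L_{u,v}\colon u\triangleleft 1_v\Rightarrow 1_{uv}$; $d^R_{x,y;v}\colon (x\cdot y)\triangleright v\Rightarrow (x\triangleright v)\cdot(y\triangleright v)$; $d^L_{u;x,y}\colon u\triangleleft(x\cdot y)\Rightarrow (u\triangleleft x)\cdot(u\triangleleft y)$; $\sigma_{x,y}\colon (x\triangleright v)\cdot(u'\triangleleft y)\Rightarrow (u\triangleleft y)\cdot(x\triangleright v')$ for $x\colon u\to u'$, $y\colon v\to v'$; $p^L_{x,v,w}\colon ((x\triangleright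 v)\triangleright w)\cdot a_{u',v,w}\Rightarrow a_{u,v,w}\cdot(x\triangleright vw)$; $p^R_{u,v,x}\colon (uv\triangleleft x)\cdot a_{u,v,w'}\Rightarrow a_{u,v,w}\cdot(u\triangleleft(v\triangleleft x))$; $p^M_{u,x,w}\colon ((u\triangleleft x)\triangleright w)\cdot a_{u,v',w}\Rightarrow a_{u,v,w}\cdot(u\triangleleft(x\triangleright w))$; $\pi_{u,v,w,z}\colon a_{uv,w,z}\cdot a_{u,v,wz}\Rightarrow \big((a_{u,v,w}\triangleright z)\cdot a_{u,vw,z}\big)\cdot(u\triangleleft a_{v,w,z})$; $n^L_x\colon (i\triangleleft x)\cdot l_{u'}\Rightarrow l_u\cdot x$; $n^R_x\colon (x\triangleright i)\cdot r_{u'}\Rightarrow r_u\cdot x$; $\tau\colon l_{i}\Rightarrow r_{i}$; $\epsilon^L_{u,v}\colon l_u\triangleright v\Rightarrow a_{i,u,v}\cdot l_{uv}$; $\epsilon^R_{u,v}\colon a_{u,v,i}\cdot(u\triangleleft r_v)\Rightarrow r_{uv}$; $\varphi_{u,v}\colon r_u\triangleright v\Rightarrow a_{u,i,v}\cdot(u\triangleleft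 l_v)$. *Polygon axioms.* In each of the following equations both sides are composites (in diagrammatic order) of natural isomorphisms between the same two functors; a bar denotes an inverse, each factor is to be vertically composed and whiskered with identities as dictated by the position in which it is used, and instances of $\alpha$ and $\bar\alpha$ are to be inserted where needed. The equations marked with a prime are the reflected versions. - (1) $\lambda_{1}=\rho_{1}$ on $1_u\cdot 1_u$. - (2) $\lambda_x=\lambda_{x\cdot y}$ on $(1\cdot x)\cdot y$; (2') $\rho_y=\rho_{x\cdot y}$ on $(x\cdot y)\cdot 1$. (3) $\lambda_y=\rho_x$ on $(x\cdot 1)\cdot y$. (4) The pentagon for $\alpha$. - (5) $d^R_{1,x;v}\,e^R\,\lambda_{x\triangleright v}=\lambda_x\triangleright v$; (5') the three analogues $d^L_{v;1,x}\,e^L\,\lambda_{v\triangleleft x}=v\triangleleft\lambda_x$, $\;d^R_{x,1;v}\,e^R\,\rho_{x\triangleright v}=\rho_x\triangleright v$, $\;d^L_{v;x,1}\,e^L\,\rho_{v\triangleleft x}=v\triangleleft\rho_x$. - (6) $\sigma_{x,1_v}\,e^L_{u,v}\,\lambda_{x\triangleright v}=e^L_{u',v}\,\rho_{x\triangleright v}$;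 (6') $\sigma_{1_u,y}\,e^R_{u,v'}\,\rho_{u\triangleleft y}=e^R_{u,v}\,\lambda_{u\triangleleft y}$. - (7) $(\alpha_{x,y,z}\triangleright v)\,d^R_{x,y\cdot z;v}\,d^R_{y,z;v}=d^R_{x\cdot y,z;v}\,d^R_{x,y;v}$; (7') the same with $d^L$. - (8) $\sigma_{x,y\cdot z}\,d^L_{u;y,z}=d^L_{u';y,z}\,\sigma_{x,y}\,\sigma_{x,z}$; (8') $\sigma_{x\cdot p,y}\,d^R_{x,p;v'}=d^R_{x,p;v}\,\sigma_{p,y}\,\sigma_{x,y}$. - (9) $p^L_{1_u,v,w}\,e^R_{u,vw}\,\rho=e^R_{u,v}\,e^R_{uv,w}\,\lambda$; (9') $p^R_{u,v,1_w}\,e^L_{v,w}\,e^L_{u,vw}\,\rho=e^L_{uv,w}\,\lambda$. - (10) $p^M_{u,1_v,w}\,e^R_{v,w}\,e^L_{u,vw}\,\rho=e^L_{u,v}\,e^R_{uv,w}\,\lambda$. - (11) $p^L_{x\cdot y,v,w}\,d^R_{x,y;vw}=d^R_{x,y;v}\,d^R_{x\triangleright v,y\triangleright v;w}\,p^L_{y,v,w}\,p^L_{x,v,w}$;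 (11') $p^R_{u,v,x\cdot y}\,d^L_{v;x,y}\,d^L_{u;v\triangleleft x,v\triangleleft y}=d^L_{uv;x,y}\,p^R_{u,v,y}\,p^R_{u,v,x}$. - (12) $p^M_{u,x\cdot y,w}\,d^R_{x,y;w}\,d^L_{u;x\triangleright w,y\triangleright w}=d^L_{u;x,y}\,d^R_{u\triangleleft x,u\triangleleft y;w}\,p^M_{u,y,w}\,p^M_{u,x,w}$. - (13) $d^R_{x\triangleright v,u'\triangleleft y;w}\,p^M_{u',y,w}\,p^L_{x,v,w}\,\sigma_{x,y\triangleright w}=\sigma_{x,y}\,d^R_{u\triangleleft y,x\triangleright v';w}\,p^L_{x,v',w}\,p^M_{u,y,w}$; (13') $\sigma_{u\triangleleft y,z}\,p^M_{u,y,w'}\,p^R_{u,v,z}=p^R_{u,v',z}\,p^M_{u,y,w}\,\bar d^L_{u;y\triangleright w,v'\triangleleft z}\,\sigma_{y,z}\,d^L_{u;v\triangleleft z,y\triangleright w'}$. - (14) $\sigma_{x\triangleright v,z}\,p^L_{x,v,w'}\,p^R_{u,v,z}=p^R_{u',v,z}\,p^L_{x,v,w}\,\sigma_{x,v\triangleleft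 z}$. - (15) $\bar\pi_{u',v,w,z}\,p^L_{x\triangleright v,w,z}\,p^L_{x,v,wz}=\bar d^R_{x\triangleright v\triangleright w,a_{u',v,w};z}\,p^L_{x,v,w}\,d^R_{a_{u,v,w},x\triangleright vw;z}\,p^L_{x,vw,z}\,\sigma_{x,a_{v,w,z}}\,\bar\pi_{u,v,w,z}$; (15') for $x\colon z\to z'$, $\bar\pi_{u,v,w,z'}\,p^R_{uv,w,x}\,p^R_{u,v,w\triangleleft x}=\bar\sigma_{a_{u,v,w},x}\,p^R_{u,vw,x}\,\bar d^L_{u;vw\triangleleft x,a_{v,w,z'}}\,p^R_{v,w,x}\,d^L_{u;a_{v,w,z},v\triangleleft w\triangleleft x}\,\bar\pi_{u,v,w,z}$. - (16) for $x\colon v\to v'$, $\bar\pi_{u,v',w,z}\,p^L_{u\triangleleft x,w,z}\,p^M_{u,x,wz}=\bar d^R_{(u\triangleleft x)\triangleright w,a_{u,v',w};z}\,p^M_{u,x,w}\,d^R_{a_{u,v,w},u\triangleleft(x\triangleright w);z}\,p^M_{u,x\triangleright w,z}\,\bar d^L_{u;x\triangleright w\triangleright z,a_{v',w,z}}\,p^L_{x,w,z}\,d^L_{u;a_{v,w,z},x\triangleright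 wz}\,\bar\pi_{u,v,w,z}$; (16') for $x\colon w\to w'$, $\bar\pi_{u,v,w',z}\,p^M_{uv,x,z}\,p^R_{u,v,x\triangleright z}=\bar d^R_{uv\triangleleft x,a_{u,v,w'};z}\,p^R_{u,v,x}\,d^R_{a_{u,v,w},u\triangleleft v\triangleleft x;z}\,p^M_{u,v\triangleleft x,z}\,\bar d^L_{u;(v\triangleleft x)\triangleright z,a_{v,w',z}}\,p^M_{v,x,z}\,d^L_{u;a_{v,w,z},v\triangleleft(x\triangleright z)}\,\bar\pi_{u,v,w,z}$. - (17) $\bar\pi_{u,v,w,y}\,d^R_{a_{uv,w,y},a_{u,v,wy};z}\,\bar\pi_{u,v,wy,z}\,\bar p^R_{u,v,a_{w,y,z}}\,\bar\pi_{uv,w,y,z}=d^R_{a_{u,v,w}\triangleright y\cdot a_{u,vw,y},u\triangleleft a_{v,w,y};z}\,d^R_{a_{u,v,w}\triangleright y,a_{u,vw,y};z}\,p^M_{u,a_{v,w,y},z}\,\bar d^L_{u;a_{v,w,y}\triangleright z,a_{v,wy,z}}\,\bar d^L_{u;a_{v,w,y}\triangleright z\cdot a_{v,wy,z},v\triangleleft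 a_{w,y,z}}\,\bar\pi_{v,w,y,z}\,d^L_{u;a_{vw,y,z},a_{v,w,yz}}\,\bar\pi_{u,vw,y,z}\,p^L_{a_{u,v,w},y,z}\,\bar\pi_{u,v,w,yz}$. - (18) $n^R_{1_u}\,\rho=e^R_{u,i}\,\lambda$; (18') $n^L_{1_u}\,\rho=e^L_{i,u}\,\lambda$. (19) $n^R_{x\cdot y}=d^R_{x,y;i}\,n^R_y\,n^R_x$; (19') $n^L_{x\cdot y}=d^L_{i;x,y}\,n^L_y\,n^L_x$. - (20) $d^R_{x\triangleright i,r_{u'};w}\,\varphi_{u',w}\,p^L_{x,i,w}\,\sigma_{x,l_w}=n^R_x\,d^R_{r_u,x;w}\,\varphi_{u,w}$; (20') $n^L_y\,d^L_{u;l_v,y}\,\bar\varphi_{u,v}=d^L_{u;i\triangleleft y,l_{v'}}\,\bar p^R_{u,i,y}\,\bar\varphi_{u,v'}\,\bar\sigma_{r_u,y}$. - (21) $\sigma_{x,r_v}\,\epsilon^R_{u,v}=\bar p^L_{x,v,i}\,\epsilon^R_{u',v}\,n^R_{x\triangleright v}$; (21') $\sigma_{l_u,y}\,\epsilon^L_{u,v'}\,p^R_{i,u,y}\,n^L_{u\triangleleft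 y}=\epsilon^L_{u,v}$. - (22) $d^R_{i\triangleleft x,l_{u'};w}\,\epsilon^L_{u',w}\,p^M_{i,x,w}\,n^L_{x\triangleright w}=n^L_x\,d^R_{l_u,x;w}\,\epsilon^L_{u,w}$; (22') $d^L_{u;x\triangleright i,r_{v'}}\,\bar p^M_{u,x,i}\,\epsilon^R_{u,v'}\,n^R_{u\triangleleft x}=n^R_x\,d^L_{u;r_v,x}\,\epsilon^R_{u,v}$. - (23) $\tau\,\varphi_{i,w}\,n^L_{l_w}=\epsilon^L_{i,w}$ on $(l_i\triangleright w)\cdot l_w$; (23') $\tau\,\epsilon^R_{u,i}=\bar\varphi_{u,i}\,n^R_{r_u}$ on $a_{u,i,i}\cdot((u\triangleleft l_i)\cdot r_u)$. - (24) $\epsilon^L_{u,i}\,\bar n^L_{r_u}\,\epsilon^R_{i,u}=n^R_{l_u}$. - (25) $p^L_{l_u,v,w}\,\epsilon^L_{u,vw}=\epsilon^L_{u,v}\,d^R_{a_{i,u,v},l_{uv};w}\,\epsilon^L_{uv,w}\,\bar n^L_{a_{u,v,w}}\,\bar\pi_{i,u,v,w}$; (25') $\bar\pi_{u,v,w,i}\,\bar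 p^R_{u,v,r_w}\,\epsilon^R_{uv,w}=\bar d^L_{u;a_{v,w,i},v\triangleleft r_w}\,\epsilon^R_{v,w}\,\epsilon^R_{u,vw}\,n^R_{a_{u,v,w}}$. - (26) $p^L_{r_u,v,w}\,\varphi_{u,vw}=\varphi_{u,v}\,d^R_{a_{u,i,v},u\triangleleft l_v;w}\,p^M_{u,l_v,w}\,\epsilon^L_{v,w}\,d^L_{u;a_{i,v,w},l_{vw}}\,\bar\pi_{u,i,v,w}$; (26') $\bar\pi_{u,v,i,w}\,\bar p^R_{u,v,l_w}\,\bar\varphi_{uv,w}=\bar d^L_{u;a_{v,i,w},v\triangleleft l_w}\,\bar\varphi_{v,w}\,\bar p^M_{u,r_v,w}\,\bar d^R_{a_{u,v,i},u\triangleleft r_v;w}\,\epsilon^R_{u,v}$. A *bicategory object in $\mathrm{CAT}$* is one in which moreover $C_0$ and $C_1$ are groupoids and $C_1\to C_0\times C_0$ and $C_2\to C_1\times_{C_0\times C_0}C_1$ are fibrations; these conditions are not used. **Tricategories.** A *tricategory* consists of sets $T_0,T_1,T_2,T_3$ with source and target maps $s,t\colon T_k\to T_{k-1}$ such that $st=ss$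 and $tt=ts$; nine maps as in the 1-data above, with $C_k$ replaced by $T_k$; eighteen maps with values in invertible 3-cells, with sources and targets as in the 2-data above; and six further maps: the spatial identity $\mathrm{id}_x\colon x\to x$, the spatial composite $f;g\colon x\to z$ of 3-cells $f\colon x\to y$ and $g\colon y\to z$, the fins $f\cdot y\colon x\cdot y\to x'\cdot y$ and $y\cdot f$, and the 3-cell whiskers $f\triangleright v\colon x\triangleright v\to x'\triangleright v$ and $u\triangleleft f$ (for $f\colon x\to x'$). These are subject to: - each 2-cell $l_u$, $r_u$, $a_{u,v,w}$ is invertible for vertical composition, up to invertible 3-cells satisfying the triangle identities; - the polygon axioms (1)–(26) and their reflections hold for the 3-cells; - (27) $\mathrm{id};f=f=f;\mathrm{id}$; (28) spatial composition is associative; (29), (31), (35), (38) the fins and 3-cell whiskers preserve spatial identities and composites; (32) $(x\cdot g);(f\cdot y')=(f\cdot y);(x'\cdot g)$ for $f\colon x\to x'$, $g\colon y\to y'$; - (30), (33), (34), (36), (37), (39), (40), (41) the 3-cells $\lambda_x$, $\rho_x$, $\alpha_{x,y,z}$, $n^R_x$, $n^L_x$, $\sigma_{x,y}$, $d^R_{x,y;v}$,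 $d^L_{v;x,y}$, $p^L_{x,v,w}$, $p^R_{u,v,x}$, $p^M_{u,x,w}$ are natural in each 2-cell variable with respect to 3-cells; for instance $(f\cdot 1_v);\rho_{x'}=\rho_x;f$ and $\big((f\triangleright v)\cdot(u'\triangleleft y)\big);\sigma_{x',y}=\sigma_{x,y};\big((u\triangleleft y)\cdot(f\triangleright v')\big)$ for $f\colon x\to x'$. **Theorem.** Let $C=(C_0,C_1,C_2)$ be a not necessarily fibrant bicategory object in $\mathrm{CAT}$ (for instance, a bicategory object in $\mathrm{CAT}$). Let $T_0,T_1,T_2$ be the sets of objects of $C_0,C_1,C_2$, and let $T_3$ be the set of morphisms $\gamma$ of $C_2$ such that $s(\gamma)$ and $t(\gamma)$ are identity morphisms of $C_1$. Let the first nine maps be the values of the nine functors on objects, let the next eighteen be the components of the eighteen natural isomorphisms, let the spatial identity and composition be those of the category $C_2$, and put $\gamma\cdot y=m_v(\gamma,\mathrm{id}_y)$, $y\cdot\gamma=m_v(\mathrm{id}_y,\gamma)$, $\gamma\triangleright u=w_r(\gamma,\mathrm{id}_u)$, $u\triangleleft\gamma=w_l(\mathrm{id}_u,\gamma)$. With these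 data $T_0,T_1,T_2,T_3$ form a tricategory. -/

import Mathlib

set_option linter.checkUnivs false

open CategoryTheory

universe u₀ u₁ u₂ u₃ v₀ v₁ v₂ w w'

namespace InternalBicat

/-! ### Tricategories -/

/-- The 0-data of a tricategory: sets of 0-, 1-, 2- and 3-cells with source and target maps. -/
structure CellSets where
  T0 : Type u₀
  T1 : Type u₁
  T2 : Type u₂
  T3 : Type u₃
  s1 : T1 → T0
  t1 : T1 → T0
  s2 : T2 → T1
  t2 : T2 → T1
  s3 : T3 → T2
  t3 : T3 → T2
  s1_t2 : ∀ x, s1 (t2 x) = s1 (s2 x)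
  t1_t2 : ∀ x, t1 (t2 x) = t1 (s2 x)
  s2_t3 : ∀ c, s2 (t3 c) = s2 (s3 c)
  t2_t3 : ∀ c, t2 (t3 c) = t2 (s3 c)

/-- The 1-cells with source `a` and target `b`. -/
@[ext] structure CellSets.One (G : CellSets.{u₀, u₁, u₂, u₃}) (a b : G.T0) where
  val : G.T1
  src : G.s1 val = a
  tgt : G.t1 val = b

/-- The 2-cells with source `u` and target `v`. -/
@[ext] structure CellSets.Two (G : CellSets.{u₀, u₁, u₂, u₃}) {a b : G.T0} (u v : G.One a b) where
  val : G.T2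
  src : G.s2 val = u.val
  tgt : G.t2 val = v.val

/-- The 3-cells with source `x` and target `y`. -/
@[ext] structure CellSets.Three (G : CellSets.{u₀, u₁, u₂, u₃}) {a b : G.T0} {u v : G.One a b}
    (x y : G.Two u v) where
  val : G.T3
  src : G.s3 val = x.val
  tgt : G.t3 val = y.val

/-- The fifteen maps of the 1-data of a tricategory that do not take values in invertible 3-cells.  A map defined on a fibre product of sets of
cells, compatible with sources and targets, is the same thing as a family of maps between the sets
of cells with prescribed boundary.  All compositions are written in diagrammatic order: `u` comes
first in `mx u v`, `x` is on top in `my x y`, `c` comes first in `mz c d`. -/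
structure CellOps (G : CellSets.{u₀, u₁, u₂, u₃}) where
  /-- horizontal identity -/
  ix (a : G.T0) : G.One a a
  /-- horizontal composition -/
  mx {a b c : G.T0} (u : G.One a b) (v : G.One b c) : G.One a c
  /-- vertical identity -/
  iy {a b : G.T0} (u : G.One a b) : G.Two u u
  /-- vertical composition -/
  my {a b : G.T0} {u v w : G.One a b} (x : G.Two u v) (y : G.Two v w) : G.Two u w
  /-- right whisker -/
  wr {a b c : G.T0} {u u' : G.One a b} (x : G.Two u u') (v : G.One b c) :
    G.Two (mx u v) (mx u' v)
  /-- left whisker -/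
  wl {a b c : G.T0} (u : G.One a b) {v v' : G.One b c} (y : G.Two v v') :
    G.Two (mx u v) (mx u v')
  /-- left identity -/
  il {a b : G.T0} (u : G.One a b) : G.Two (mx (ix a) u) u
  /-- right identity -/
  ir {a b : G.T0} (u : G.One a b) : G.Two (mx u (ix b)) u
  /-- horizontal associator -/
  ax {a b c d : G.T0} (u : G.One a b) (v : G.One b c) (w : G.One c d) :
    G.Two (mx (mx u v) w) (mx u (mx v w))
  /-- spatial identity -/
  iz {a b : G.T0} {u v : G.One a b} (x : G.Two u v) : G.Three x x
  /-- spatial composition -/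
  mz {a b : G.T0} {u v : G.One a b} {x y z : G.Two u v} (c : G.Three x y) (d : G.Three y z) :
    G.Three x z
  /-- bottom fin -/
  fb {a b : G.T0} {u v w : G.One a b} {x x' : G.Two u v} (c : G.Three x x') (y : G.Two v w) :
    G.Three (my x y) (my x' y)
  /-- top fin -/
  ft {a b : G.T0} {u v w : G.One a b} (x : G.Two u v) {y y' : G.Two v w} (c : G.Three y y') :
    G.Three (my x y) (my x y')
  /-- right 3-cell whisker -/
  hr {a b c : G.T0} {u u' : G.One a b} {x x' : G.Two u u'} (f : G.Three x x') (v : G.One b c) :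
    G.Three (wr x v) (wr x' v)
  /-- left 3-cell whisker -/
  hl {a b c : G.T0} (u : G.One a b) {v v' : G.One b c} {y y' : G.Two v v'} (f : G.Three y y') :
    G.Three (wl u y) (wl u y')

/-- An invertible 3-cell from `x` to `y`, together with its inverse.  (Inverses are unique as soon
as spatial composition is unital and associative, as it is in a tricategory.) -/
structure CellOps.Inv3 {G : CellSets.{u₀, u₁, u₂, u₃}} (O : CellOps G) {a b : G.T0}
    {u v : G.One a b} (x y : G.Two u v) where
  hom : G.Three x y
  inv : G.Three y x
  hom_inv : O.mz hom inv = O.iz x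
  inv_hom : O.mz inv hom = O.iz y

/-- The thirty-three maps of the 1-data of a tricategory: the fifteen operations, and eighteen maps
with values in invertible 3-cells. -/
structure TricatData (G : CellSets.{u₀, u₁, u₂, u₃}) extends CellOps G where
  /-- top identity -/
  it {a b : G.T0} {u v : G.One a b} (x : G.Two u v) : toCellOps.Inv3 (my (iy u) x) x
  /-- bottom identity -/
  ib {a b : G.T0} {u v : G.One a b} (x : G.Two u v) : toCellOps.Inv3 (my x (iy v)) x
  /-- vertical associator -/
  ay {a b : G.T0} {u v w z : G.One a b} (x : G.Two u v) (y : G.Two v w) (r : G.Two w z) :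
    toCellOps.Inv3 (my (my x y) r) (my x (my y r))
  /-- vertical identity expansion right -/
  evr {a b c : G.T0} (u : G.One a b) (v : G.One b c) :
    toCellOps.Inv3 (wr (iy u) v) (iy (mx u v))
  /-- vertical identity expansion left -/
  evl {a b c : G.T0} (u : G.One a b) (v : G.One b c) :
    toCellOps.Inv3 (wl u (iy v)) (iy (mx u v))
  /-- dewhisker right -/
  dwr {a b c : G.T0} {u u' u'' : G.One a b} (x : G.Two u u') (y : G.Two u' u'') (v : G.One b c) :
    toCellOps.Inv3 (wr (my x y) v) (my (wr x v) (wr y v))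
  /-- dewhisker left -/
  dwl {a b c : G.T0} (u : G.One a b) {v v' v'' : G.One b c} (x : G.Two v v') (y : G.Two v' v'') :
    toCellOps.Inv3 (wl u (my x y)) (my (wl u x) (wl u y))
  /-- switch -/
  sw {a b c : G.T0} {u u' : G.One a b} {v v' : G.One b c} (x : G.Two u u') (y : G.Two v v') :
    toCellOps.Inv3 (my (wr x v) (wl u' y)) (my (wl u y) (wr x v'))
  /-- pass left -/
  pl {a b c d : G.T0} {u u' : G.One a b} (x : G.Two u u') (v : G.One b c) (w : G.One c d) :
    toCellOps.Inv3 (my (wr (wr x v) w) (ax u' v w)) (my (ax u v w) (wr x (mx v w)))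
  /-- pass right -/
  pr {a b c d : G.T0} (u : G.One a b) (v : G.One b c) {w w' : G.One c d} (x : G.Two w w') :
    toCellOps.Inv3 (my (wl (mx u v) x) (ax u v w')) (my (ax u v w) (wl u (wl v x)))
  /-- pass middle -/
  pm {a b c d : G.T0} (u : G.One a b) {v v' : G.One b c} (x : G.Two v v') (w : G.One c d) :
    toCellOps.Inv3 (my (wr (wl u x) w) (ax u v' w)) (my (ax u v w) (wl u (wr x w)))
  /-- pentagonator -/
  pn {a b c d e : G.T0} (u : G.One a b) (v : G.One b c) (w : G.One c d) (z : G.One d e) :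
    toCellOps.Inv3 (my (ax (mx u v) w z) (ax u v (mx w z)))
      (my (my (wr (ax u v w) z) (ax u (mx v w) z)) (wl u (ax v w z)))
  /-- left identity pass -/
  pil {a b : G.T0} {u u' : G.One a b} (x : G.Two u u') :
    toCellOps.Inv3 (my (wl (ix a) x) (il u')) (my (il u) x)
  /-- right identity pass -/
  pir {a b : G.T0} {u u' : G.One a b} (x : G.Two u u') :
    toCellOps.Inv3 (my (wr x (ix b)) (ir u')) (my (ir u) x)
  /-- swap -/
  sp (a : G.T0) : toCellOps.Inv3 (il (ix a)) (ir (ix a))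
  /-- left identity expansion -/
  eli {a b c : G.T0} (u : G.One a b) (v : G.One b c) :
    toCellOps.Inv3 (wr (il u) v) (my (ax (ix a) u v) (il (mx u v)))
  /-- right identity expansion -/
  eri {a b c : G.T0} (u : G.One a b) (v : G.One b c) :
    toCellOps.Inv3 (my (ax u v (ix c)) (wl u (ir v))) (ir (mx u v))
  /-- flip -/
  fp {a b c : G.T0} (u : G.One a b) (v : G.One b c) :
    toCellOps.Inv3 (wr (ir u) v) (my (ax u (ix b) v) (wl u (il v)))

section Axioms

variable {G : CellSets.{u₀, u₁, u₂, u₃}} (D : TricatData G)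

local infixl:75 " ⋄ " => CellOps.mx (TricatData.toCellOps D)
local infixl:70 " ⊙ " => CellOps.my (TricatData.toCellOps D)
local infixl:72 " ▹ " => CellOps.wr (TricatData.toCellOps D)
local infixr:72 " ◃ " => CellOps.wl (TricatData.toCellOps D)
local infixr:60 " ⟫ " => CellOps.mz (TricatData.toCellOps D)

/-- The two triangle identities for invertible 3-cells `C`, `E` exhibiting `c'` as an inverse of
`c`. -/
def TricatData.Triangles {a b : G.T0} {u v : G.One a b} (c : G.Two u v) (c' : G.Two v u)
    (C : D.Inv3 (c ⊙ c') (D.iy u)) (E : D.Inv3 (c' ⊙ c) (D.iy v)) : Prop :=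
  D.fb C.hom c ⟫ (D.it c).hom = ((D.ay c c' c).hom ⟫ D.ft c E.hom) ⟫ (D.ib c).hom ∧
    D.fb E.hom c' ⟫ (D.it c').hom = ((D.ay c' c c').hom ⟫ D.ft c' C.hom) ⟫ (D.ib c').hom

/-- Invertibility of a 2-cell: a two-sided inverse up to invertible 3-cells satisfying the two
triangle identities. -/
def TricatData.Invertible2 {a b : G.T0} {u v : G.One a b} (c : G.Two u v) : Prop :=
  ∃ (c' : G.Two v u) (C : D.Inv3 (c ⊙ c') (D.iy u)) (E : D.Inv3 (c' ⊙ c) (D.iy v)),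
    D.Triangles c c' C E

/-- The forty-six polygon axioms (axiom groups 1 to 26 and their reflections).  Each of them says
that the composite of all the edges of a polygon of invertible 3-cells is an identity; this is
stated as the equality of the two composites between two chosen vertices, an edge traversed
backwards being replaced by the inverse 3-cell.  A name ending in `x`, `y` or `xy` marks the
reflected version.  The comment above an axiom shows the pasting scheme it belongs to: `|` separates
horizontally composed columns, `i` is an identity 1-cell, `1` an identity 2-cell, and juxtaposed
letters are vertically composed 2-cells. -/
structure TricatData.PolygonAxioms : Prop where
  /-- 1 1 -/
  ax1 : ∀ {a b : G.T0} (u : G.One a b), (D.it (D.iy u)).hom = (D.ib (D.iy u)).hom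
  /-- 1 x y -/
  ax2 : ∀ {a b : G.T0} {u v w : G.One a b} (x : G.Two u v) (y : G.Two v w),
    D.fb (D.it x).hom y = (D.ay (D.iy u) x y).hom ⟫ (D.it (x ⊙ y)).hom
  /-- x y 1 -/
  ax2y : ∀ {a b : G.T0} {u v w : G.One a b} (x : G.Two u v) (y : G.Two v w),
    (D.ay x y (D.iy w)).hom ⟫ D.ft x (D.ib y).hom = (D.ib (x ⊙ y)).hom
  /-- x 1 y -/
  ax3 : ∀ {a b : G.T0} {u v w : G.One a b} (x : G.Two u v) (y : G.Two v w),
    (D.ay x (D.iy v) y).hom ⟫ D.ft x (D.it y).hom = D.fb (D.ib x).hom y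
  /-- x y p q -/
  ax4 : ∀ {a b : G.T0} {u v w z t : G.One a b} (x : G.Two u v) (y : G.Two v w) (p : G.Two w z)
    (q : G.Two z t),
    D.fb (D.ay x y p).hom q ⟫ (D.ay x (y ⊙ p) q).hom ⟫ D.ft x (D.ay y p q).hom =
      (D.ay (x ⊙ y) p q).hom ⟫ (D.ay x y (p ⊙ q)).hom
  /-- 1 x | v -/
  ax5 : ∀ {a b c : G.T0} {u u' : G.One a b} (x : G.Two u u') (v : G.One b c),
    (D.dwr (D.iy u) x v).hom ⟫ D.fb (D.evr u v).hom (x ▹ v) ⟫ (D.it (x ▹ v)).hom =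
      D.hr (D.it x).hom v
  /-- v | 1 x -/
  ax5x : ∀ {a b c : G.T0} (v : G.One a b) {u u' : G.One b c} (x : G.Two u u'),
    (D.dwl v (D.iy u) x).hom ⟫ D.fb (D.evl v u).hom (v ◃ x) ⟫ (D.it (v ◃ x)).hom =
      D.hl v (D.it x).hom
  /-- x 1 | v -/
  ax5y : ∀ {a b c : G.T0} {u u' : G.One a b} (x : G.Two u u') (v : G.One b c),
    (D.dwr x (D.iy u') v).hom ⟫ D.ft (x ▹ v) (D.evr u' v).hom ⟫ (D.ib (x ▹ v)).hom =
      D.hr (D.ib x).hom v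
  /-- v | x 1 -/
  ax5xy : ∀ {a b c : G.T0} (v : G.One a b) {u u' : G.One b c} (x : G.Two u u'),
    (D.dwl v x (D.iy u')).hom ⟫ D.ft (v ◃ x) (D.evl v u').hom ⟫ (D.ib (v ◃ x)).hom =
      D.hl v (D.ib x).hom
  /-- x | 1 -/
  ax6 : ∀ {a b c : G.T0} {u u' : G.One a b} (x : G.Two u u') (v : G.One b c),
    (D.sw x (D.iy v)).hom ⟫ D.fb (D.evl u v).hom (x ▹ v) ⟫ (D.it (x ▹ v)).hom =
      D.ft (x ▹ v) (D.evl u' v).hom ⟫ (D.ib (x ▹ v)).hom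
  /-- 1 | y -/
  ax6x : ∀ {a b c : G.T0} (u : G.One a b) {v v' : G.One b c} (y : G.Two v v'),
    (D.sw (D.iy u) y).hom ⟫ D.ft (u ◃ y) (D.evr u v').hom ⟫ (D.ib (u ◃ y)).hom =
      D.fb (D.evr u v).hom (u ◃ y) ⟫ (D.it (u ◃ y)).hom
  /-- x y z | v -/
  ax7 : ∀ {a b c : G.T0} {u u' u'' u''' : G.One a b} (x : G.Two u u') (y : G.Two u' u'')
    (z : G.Two u'' u''') (v : G.One b c),
    D.hr (D.ay x y z).hom v ⟫ (D.dwr x (y ⊙ z) v).hom ⟫ D.ft (x ▹ v) (D.dwr y z v).hom =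
      (D.dwr (x ⊙ y) z v).hom ⟫ D.fb (D.dwr x y v).hom (z ▹ v) ⟫
        (D.ay (x ▹ v) (y ▹ v) (z ▹ v)).hom
  /-- v | x y z -/
  ax7x : ∀ {a b c : G.T0} (v : G.One a b) {u u' u'' u''' : G.One b c} (x : G.Two u u')
    (y : G.Two u' u'') (z : G.Two u'' u'''),
    D.hl v (D.ay x y z).hom ⟫ (D.dwl v x (y ⊙ z)).hom ⟫ D.ft (v ◃ x) (D.dwl v y z).hom =
      (D.dwl v (x ⊙ y) z).hom ⟫ D.fb (D.dwl v x y).hom (v ◃ z) ⟫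
        (D.ay (v ◃ x) (v ◃ y) (v ◃ z)).hom
  /-- x | y z -/
  ax8 : ∀ {a b c : G.T0} {u u' : G.One a b} {v v' v'' : G.One b c} (x : G.Two u u')
    (y : G.Two v v') (z : G.Two v' v''),
    (D.sw x (y ⊙ z)).hom ⟫ D.fb (D.dwl u y z).hom (x ▹ v'') ⟫
        (D.ay (u ◃ y) (u ◃ z) (x ▹ v'')).hom =
      D.ft (x ▹ v) (D.dwl u' y z).hom ⟫ (D.ay (x ▹ v) (u' ◃ y) (u' ◃ z)).inv ⟫
        D.fb (D.sw x y).hom (u' ◃ z) ⟫ (D.ay (u ◃ y) (x ▹ v') (u' ◃ z)).hom ⟫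
        D.ft (u ◃ y) (D.sw x z).hom
  /-- x p | y -/
  ax8x : ∀ {a b c : G.T0} {u u' u'' : G.One a b} {v v' : G.One b c} (x : G.Two u u')
    (p : G.Two u' u'') (y : G.Two v v'),
    (D.sw (x ⊙ p) y).hom ⟫ D.ft (u ◃ y) (D.dwr x p v').hom =
      D.fb (D.dwr x p v).hom (u'' ◃ y) ⟫ (D.ay (x ▹ v) (p ▹ v) (u'' ◃ y)).hom ⟫
        D.ft (x ▹ v) (D.sw p y).hom ⟫ (D.ay (x ▹ v) (u' ◃ y) (p ▹ v')).inv ⟫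
        D.fb (D.sw x y).hom (p ▹ v') ⟫ (D.ay (u ◃ y) (x ▹ v') (p ▹ v')).hom
  /-- 1 | v | w -/
  ax9 : ∀ {a b c d : G.T0} (u : G.One a b) (v : G.One b c) (w : G.One c d),
    (D.pl (D.iy u) v w).hom ⟫ D.ft (D.ax u v w) (D.evr u (v ⋄ w)).hom ⟫ (D.ib (D.ax u v w)).hom =
      D.fb (D.hr (D.evr u v).hom w) (D.ax u v w) ⟫ D.fb (D.evr (u ⋄ v) w).hom (D.ax u v w) ⟫
        (D.it (D.ax u v w)).hom
  /-- u | v | 1 -/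
  ax9x : ∀ {a b c d : G.T0} (u : G.One a b) (v : G.One b c) (w : G.One c d),
    (D.pr u v (D.iy w)).hom ⟫ D.ft (D.ax u v w) (D.hl u (D.evl v w).hom) ⟫
        D.ft (D.ax u v w) (D.evl u (v ⋄ w)).hom ⟫ (D.ib (D.ax u v w)).hom =
      D.fb (D.evl (u ⋄ v) w).hom (D.ax u v w) ⟫ (D.it (D.ax u v w)).hom
  /-- u | 1 | w -/
  ax10 : ∀ {a b c d : G.T0} (u : G.One a b) (v : G.One b c) (w : G.One c d),
    (D.pm u (D.iy v) w).hom ⟫ D.ft (D.ax u v w) (D.hl u (D.evr v w).hom) ⟫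
        D.ft (D.ax u v w) (D.evl u (v ⋄ w)).hom ⟫ (D.ib (D.ax u v w)).hom =
      D.fb (D.hr (D.evl u v).hom w) (D.ax u v w) ⟫ D.fb (D.evr (u ⋄ v) w).hom (D.ax u v w) ⟫
        (D.it (D.ax u v w)).hom
  /-- x y | v | w -/
  ax11 : ∀ {a b c d : G.T0} {u u' u'' : G.One a b} (x : G.Two u u') (y : G.Two u' u'')
    (v : G.One b c) (w : G.One c d),
    (D.pl (x ⊙ y) v w).hom ⟫ D.ft (D.ax u v w) (D.dwr x y (v ⋄ w)).hom =
      D.fb (D.hr (D.dwr x y v).hom w) (D.ax u'' v w) ⟫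
        D.fb (D.dwr (x ▹ v) (y ▹ v) w).hom (D.ax u'' v w) ⟫
        (D.ay (x ▹ v ▹ w) (y ▹ v ▹ w) (D.ax u'' v w)).hom ⟫
        D.ft (x ▹ v ▹ w) (D.pl y v w).hom ⟫
        (D.ay (x ▹ v ▹ w) (D.ax u' v w) (y ▹ (v ⋄ w))).inv ⟫
        D.fb (D.pl x v w).hom (y ▹ (v ⋄ w)) ⟫
        (D.ay (D.ax u v w) (x ▹ (v ⋄ w)) (y ▹ (v ⋄ w))).hom
  /-- u | v | x y -/
  ax11x : ∀ {a b c d : G.T0} (u : G.One a b) (v : G.One b c) {w w' w'' : G.One c d}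
    (x : G.Two w w') (y : G.Two w' w''),
    (D.pr u v (x ⊙ y)).hom ⟫ D.ft (D.ax u v w) (D.hl u (D.dwl v x y).hom) ⟫
        D.ft (D.ax u v w) (D.dwl u (v ◃ x) (v ◃ y)).hom =
      D.fb (D.dwl (u ⋄ v) x y).hom (D.ax u v w'') ⟫
        (D.ay ((u ⋄ v) ◃ x) ((u ⋄ v) ◃ y) (D.ax u v w'')).hom ⟫
        D.ft ((u ⋄ v) ◃ x) (D.pr u v y).hom ⟫
        (D.ay ((u ⋄ v) ◃ x) (D.ax u v w') (u ◃ v ◃ y)).inv ⟫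
        D.fb (D.pr u v x).hom (u ◃ v ◃ y) ⟫
        (D.ay (D.ax u v w) (u ◃ v ◃ x) (u ◃ v ◃ y)).hom
  /-- u | x y | w -/
  ax12 : ∀ {a b c d : G.T0} (u : G.One a b) {v v' v'' : G.One b c} (x : G.Two v v')
    (y : G.Two v' v'') (w : G.One c d),
    (D.pm u (x ⊙ y) w).hom ⟫ D.ft (D.ax u v w) (D.hl u (D.dwr x y w).hom) ⟫
        D.ft (D.ax u v w) (D.dwl u (x ▹ w) (y ▹ w)).hom =
      D.fb (D.hr (D.dwl u x y).hom w) (D.ax u v'' w) ⟫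
        D.fb (D.dwr (u ◃ x) (u ◃ y) w).hom (D.ax u v'' w) ⟫
        (D.ay ((u ◃ x) ▹ w) ((u ◃ y) ▹ w) (D.ax u v'' w)).hom ⟫
        D.ft ((u ◃ x) ▹ w) (D.pm u y w).hom ⟫
        (D.ay ((u ◃ x) ▹ w) (D.ax u v' w) (u ◃ (y ▹ w))).inv ⟫
        D.fb (D.pm u x w).hom (u ◃ (y ▹ w)) ⟫
        (D.ay (D.ax u v w) (u ◃ (x ▹ w)) (u ◃ (y ▹ w))).hom
  /-- x | y | w -/
  ax13 : ∀ {a b c d : G.T0} {u u' : G.One a b} {v v' : G.One b c} (x : G.Two u u')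
    (y : G.Two v v') (w : G.One c d),
    D.fb (D.dwr (x ▹ v) (u' ◃ y) w).hom (D.ax u' v' w) ⟫
        (D.ay (x ▹ v ▹ w) ((u' ◃ y) ▹ w) (D.ax u' v' w)).hom ⟫
        D.ft (x ▹ v ▹ w) (D.pm u' y w).hom ⟫
        (D.ay (x ▹ v ▹ w) (D.ax u' v w) (u' ◃ (y ▹ w))).inv ⟫
        D.fb (D.pl x v w).hom (u' ◃ (y ▹ w)) ⟫
        (D.ay (D.ax u v w) (x ▹ (v ⋄ w)) (u' ◃ (y ▹ w))).hom ⟫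
        D.ft (D.ax u v w) (D.sw x (y ▹ w)).hom =
      D.fb (D.hr (D.sw x y).hom w) (D.ax u' v' w) ⟫
        D.fb (D.dwr (u ◃ y) (x ▹ v') w).hom (D.ax u' v' w) ⟫
        (D.ay ((u ◃ y) ▹ w) (x ▹ v' ▹ w) (D.ax u' v' w)).hom ⟫
        D.ft ((u ◃ y) ▹ w) (D.pl x v' w).hom ⟫
        (D.ay ((u ◃ y) ▹ w) (D.ax u v' w) (x ▹ (v' ⋄ w))).inv ⟫
        D.fb (D.pm u y w).hom (x ▹ (v' ⋄ w)) ⟫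
        (D.ay (D.ax u v w) (u ◃ (y ▹ w)) (x ▹ (v' ⋄ w))).hom
  /-- u | y | z -/
  ax13x : ∀ {a b c d : G.T0} (u : G.One a b) {v v' : G.One b c} {w w' : G.One c d}
    (y : G.Two v v') (z : G.Two w w'),
    D.fb (D.sw (u ◃ y) z).hom (D.ax u v' w') ⟫
        (D.ay ((u ⋄ v) ◃ z) ((u ◃ y) ▹ w') (D.ax u v' w')).hom ⟫
        D.ft ((u ⋄ v) ◃ z) (D.pm u y w').hom ⟫
        (D.ay ((u ⋄ v) ◃ z) (D.ax u v w') (u ◃ (y ▹ w'))).inv ⟫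
        D.fb (D.pr u v z).hom (u ◃ (y ▹ w')) ⟫
        (D.ay (D.ax u v w) (u ◃ v ◃ z) (u ◃ (y ▹ w'))).hom =
      (D.ay ((u ◃ y) ▹ w) ((u ⋄ v') ◃ z) (D.ax u v' w')).hom ⟫
        D.ft ((u ◃ y) ▹ w) (D.pr u v' z).hom ⟫
        (D.ay ((u ◃ y) ▹ w) (D.ax u v' w) (u ◃ v' ◃ z)).inv ⟫
        D.fb (D.pm u y w).hom (u ◃ v' ◃ z) ⟫
        (D.ay (D.ax u v w) (u ◃ (y ▹ w)) (u ◃ v' ◃ z)).hom ⟫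
        D.ft (D.ax u v w) (D.dwl u (y ▹ w) (v' ◃ z)).inv ⟫
        D.ft (D.ax u v w) (D.hl u (D.sw y z).hom) ⟫
        D.ft (D.ax u v w) (D.dwl u (v ◃ z) (y ▹ w')).hom
  /-- x | v | z -/
  ax14 : ∀ {a b c d : G.T0} {u u' : G.One a b} {w w' : G.One c d} (x : G.Two u u')
    (v : G.One b c) (z : G.Two w w'),
    D.fb (D.sw (x ▹ v) z).hom (D.ax u' v w') ⟫
        (D.ay ((u ⋄ v) ◃ z) (x ▹ v ▹ w') (D.ax u' v w')).hom ⟫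
        D.ft ((u ⋄ v) ◃ z) (D.pl x v w').hom ⟫
        (D.ay ((u ⋄ v) ◃ z) (D.ax u v w') (x ▹ (v ⋄ w'))).inv ⟫
        D.fb (D.pr u v z).hom (x ▹ (v ⋄ w')) ⟫
        (D.ay (D.ax u v w) (u ◃ v ◃ z) (x ▹ (v ⋄ w'))).hom =
      (D.ay (x ▹ v ▹ w) ((u' ⋄ v) ◃ z) (D.ax u' v w')).hom ⟫
        D.ft (x ▹ v ▹ w) (D.pr u' v z).hom ⟫
        (D.ay (x ▹ v ▹ w) (D.ax u' v w) (u' ◃ v ◃ z)).inv ⟫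
        D.fb (D.pl x v w).hom (u' ◃ v ◃ z) ⟫
        (D.ay (D.ax u v w) (x ▹ (v ⋄ w)) (u' ◃ v ◃ z)).hom ⟫
        D.ft (D.ax u v w) (D.sw x (v ◃ z)).hom
  /-- x | v | w | z -/
  ax15 : ∀ {a b c d e : G.T0} {u u' : G.One a b} (x : G.Two u u') (v : G.One b c)
    (w : G.One c d) (z : G.One d e),
    D.ft (x ▹ v ▹ w ▹ z) (D.pn u' v w z).inv ⟫
        (D.ay (x ▹ v ▹ w ▹ z) (D.ax (u' ⋄ v) w z) (D.ax u' v (w ⋄ z))).inv ⟫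
        D.fb (D.pl (x ▹ v) w z).hom (D.ax u' v (w ⋄ z)) ⟫
        (D.ay (D.ax (u ⋄ v) w z) (x ▹ v ▹ (w ⋄ z)) (D.ax u' v (w ⋄ z))).hom ⟫
        D.ft (D.ax (u ⋄ v) w z) (D.pl x v (w ⋄ z)).hom ⟫
        (D.ay (D.ax (u ⋄ v) w z) (D.ax u v (w ⋄ z)) (x ▹ (v ⋄ (w ⋄ z)))).inv =
      (D.ay (x ▹ v ▹ w ▹ z) (D.ax u' v w ▹ z ⊙ D.ax u' (v ⋄ w) z) (u' ◃ D.ax v w z)).inv ⟫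
        D.fb (D.ay (x ▹ v ▹ w ▹ z) (D.ax u' v w ▹ z) (D.ax u' (v ⋄ w) z)).inv
          (u' ◃ D.ax v w z) ⟫
        D.fb (D.fb (D.dwr (x ▹ v ▹ w) (D.ax u' v w) z).inv (D.ax u' (v ⋄ w) z))
          (u' ◃ D.ax v w z) ⟫
        D.fb (D.fb (D.hr (D.pl x v w).hom z) (D.ax u' (v ⋄ w) z)) (u' ◃ D.ax v w z) ⟫
        D.fb (D.fb (D.dwr (D.ax u v w) (x ▹ (v ⋄ w)) z).hom (D.ax u' (v ⋄ w) z))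
          (u' ◃ D.ax v w z) ⟫
        D.fb (D.ay (D.ax u v w ▹ z) (x ▹ (v ⋄ w) ▹ z) (D.ax u' (v ⋄ w) z)).hom
          (u' ◃ D.ax v w z) ⟫
        D.fb (D.ft (D.ax u v w ▹ z) (D.pl x (v ⋄ w) z).hom) (u' ◃ D.ax v w z) ⟫
        D.fb (D.ay (D.ax u v w ▹ z) (D.ax u (v ⋄ w) z) (x ▹ (v ⋄ w ⋄ z))).inv
          (u' ◃ D.ax v w z) ⟫
        (D.ay (D.ax u v w ▹ z ⊙ D.ax u (v ⋄ w) z) (x ▹ (v ⋄ w ⋄ z)) (u' ◃ D.ax v w z)).hom ⟫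
        D.ft (D.ax u v w ▹ z ⊙ D.ax u (v ⋄ w) z) (D.sw x (D.ax v w z)).hom ⟫
        (D.ay (D.ax u v w ▹ z ⊙ D.ax u (v ⋄ w) z) (u ◃ D.ax v w z) (x ▹ (v ⋄ (w ⋄ z)))).inv ⟫
        D.fb (D.pn u v w z).inv (x ▹ (v ⋄ (w ⋄ z)))
  /-- u | v | w | x -/
  ax15x : ∀ {a b c d e : G.T0} (u : G.One a b) (v : G.One b c) (w : G.One c d)
    {z z' : G.One d e} (x : G.Two z z'),
    D.ft ((u ⋄ v ⋄ w) ◃ x) (D.pn u v w z').inv ⟫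
        (D.ay ((u ⋄ v ⋄ w) ◃ x) (D.ax (u ⋄ v) w z') (D.ax u v (w ⋄ z'))).inv ⟫
        D.fb (D.pr (u ⋄ v) w x).hom (D.ax u v (w ⋄ z')) ⟫
        (D.ay (D.ax (u ⋄ v) w z) ((u ⋄ v) ◃ w ◃ x) (D.ax u v (w ⋄ z'))).hom ⟫
        D.ft (D.ax (u ⋄ v) w z) (D.pr u v (w ◃ x)).hom ⟫
        (D.ay (D.ax (u ⋄ v) w z) (D.ax u v (w ⋄ z)) (u ◃ v ◃ w ◃ x)).inv =
      (D.ay ((u ⋄ v ⋄ w) ◃ x) (D.ax u v w ▹ z' ⊙ D.ax u (v ⋄ w) z') (u ◃ D.ax v w z')).inv ⟫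
        D.fb (D.ay ((u ⋄ v ⋄ w) ◃ x) (D.ax u v w ▹ z') (D.ax u (v ⋄ w) z')).inv
          (u ◃ D.ax v w z') ⟫
        D.fb (D.fb (D.sw (D.ax u v w) x).inv (D.ax u (v ⋄ w) z')) (u ◃ D.ax v w z') ⟫
        D.fb (D.ay (D.ax u v w ▹ z) ((u ⋄ (v ⋄ w)) ◃ x) (D.ax u (v ⋄ w) z')).hom
          (u ◃ D.ax v w z') ⟫
        D.fb (D.ft (D.ax u v w ▹ z) (D.pr u (v ⋄ w) x).hom) (u ◃ D.ax v w z') ⟫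
        D.fb (D.ay (D.ax u v w ▹ z) (D.ax u (v ⋄ w) z) (u ◃ (v ⋄ w) ◃ x)).inv
          (u ◃ D.ax v w z') ⟫
        (D.ay (D.ax u v w ▹ z ⊙ D.ax u (v ⋄ w) z) (u ◃ (v ⋄ w) ◃ x) (u ◃ D.ax v w z')).hom ⟫
        D.ft (D.ax u v w ▹ z ⊙ D.ax u (v ⋄ w) z) (D.dwl u ((v ⋄ w) ◃ x) (D.ax v w z')).inv ⟫
        D.ft (D.ax u v w ▹ z ⊙ D.ax u (v ⋄ w) z) (D.hl u (D.pr v w x).hom) ⟫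
        D.ft (D.ax u v w ▹ z ⊙ D.ax u (v ⋄ w) z) (D.dwl u (D.ax v w z) (v ◃ w ◃ x)).hom ⟫
        (D.ay (D.ax u v w ▹ z ⊙ D.ax u (v ⋄ w) z) (u ◃ D.ax v w z) (u ◃ v ◃ w ◃ x)).inv ⟫
        D.fb (D.pn u v w z).inv (u ◃ v ◃ w ◃ x)
  /-- u | x | w | z -/
  ax16 : ∀ {a b c d e : G.T0} (u : G.One a b) {v v' : G.One b c} (x : G.Two v v')
    (w : G.One c d) (z : G.One d e),
    D.ft ((u ◃ x) ▹ w ▹ z) (D.pn u v' w z).inv ⟫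
        (D.ay ((u ◃ x) ▹ w ▹ z) (D.ax (u ⋄ v') w z) (D.ax u v' (w ⋄ z))).inv ⟫
        D.fb (D.pl (u ◃ x) w z).hom (D.ax u v' (w ⋄ z)) ⟫
        (D.ay (D.ax (u ⋄ v) w z) ((u ◃ x) ▹ (w ⋄ z)) (D.ax u v' (w ⋄ z))).hom ⟫
        D.ft (D.ax (u ⋄ v) w z) (D.pm u x (w ⋄ z)).hom ⟫
        (D.ay (D.ax (u ⋄ v) w z) (D.ax u v (w ⋄ z)) (u ◃ (x ▹ (w ⋄ z)))).inv =
      (D.ay ((u ◃ x) ▹ w ▹ z) (D.ax u v' w ▹ z ⊙ D.ax u (v' ⋄ w) z) (u ◃ D.ax v' w z)).inv ⟫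
        D.fb (D.ay ((u ◃ x) ▹ w ▹ z) (D.ax u v' w ▹ z) (D.ax u (v' ⋄ w) z)).inv
          (u ◃ D.ax v' w z) ⟫
        D.fb (D.fb (D.dwr ((u ◃ x) ▹ w) (D.ax u v' w) z).inv (D.ax u (v' ⋄ w) z))
          (u ◃ D.ax v' w z) ⟫
        D.fb (D.fb (D.hr (D.pm u x w).hom z) (D.ax u (v' ⋄ w) z)) (u ◃ D.ax v' w z) ⟫
        D.fb (D.fb (D.dwr (D.ax u v w) (u ◃ (x ▹ w)) z).hom (D.ax u (v' ⋄ w) z))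
          (u ◃ D.ax v' w z) ⟫
        D.fb (D.ay (D.ax u v w ▹ z) ((u ◃ (x ▹ w)) ▹ z) (D.ax u (v' ⋄ w) z)).hom
          (u ◃ D.ax v' w z) ⟫
        D.fb (D.ft (D.ax u v w ▹ z) (D.pm u (x ▹ w) z).hom) (u ◃ D.ax v' w z) ⟫
        D.fb (D.ay (D.ax u v w ▹ z) (D.ax u (v ⋄ w) z) (u ◃ (x ▹ w ▹ z))).inv
          (u ◃ D.ax v' w z) ⟫
        (D.ay (D.ax u v w ▹ z ⊙ D.ax u (v ⋄ w) z) (u ◃ (x ▹ w ▹ z)) (u ◃ D.ax v' w z)).hom ⟫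
        D.ft (D.ax u v w ▹ z ⊙ D.ax u (v ⋄ w) z) (D.dwl u (x ▹ w ▹ z) (D.ax v' w z)).inv ⟫
        D.ft (D.ax u v w ▹ z ⊙ D.ax u (v ⋄ w) z) (D.hl u (D.pl x w z).hom) ⟫
        D.ft (D.ax u v w ▹ z ⊙ D.ax u (v ⋄ w) z) (D.dwl u (D.ax v w z) (x ▹ (w ⋄ z))).hom ⟫
        (D.ay (D.ax u v w ▹ z ⊙ D.ax u (v ⋄ w) z) (u ◃ D.ax v w z) (u ◃ (x ▹ (w ⋄ z)))).inv ⟫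
        D.fb (D.pn u v w z).inv (u ◃ (x ▹ (w ⋄ z)))
  /-- u | v | x | z -/
  ax16x : ∀ {a b c d e : G.T0} (u : G.One a b) (v : G.One b c) {w w' : G.One c d}
    (x : G.Two w w') (z : G.One d e),
    D.ft (((u ⋄ v) ◃ x) ▹ z) (D.pn u v w' z).inv ⟫
        (D.ay (((u ⋄ v) ◃ x) ▹ z) (D.ax (u ⋄ v) w' z) (D.ax u v (w' ⋄ z))).inv ⟫
        D.fb (D.pm (u ⋄ v) x z).hom (D.ax u v (w' ⋄ z)) ⟫
        (D.ay (D.ax (u ⋄ v) w z) ((u ⋄ v) ◃ (x ▹ z)) (D.ax u v (w' ⋄ z))).hom ⟫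
        D.ft (D.ax (u ⋄ v) w z) (D.pr u v (x ▹ z)).hom ⟫
        (D.ay (D.ax (u ⋄ v) w z) (D.ax u v (w ⋄ z)) (u ◃ v ◃ (x ▹ z))).inv =
      (D.ay (((u ⋄ v) ◃ x) ▹ z) (D.ax u v w' ▹ z ⊙ D.ax u (v ⋄ w') z) (u ◃ D.ax v w' z)).inv ⟫
        D.fb (D.ay (((u ⋄ v) ◃ x) ▹ z) (D.ax u v w' ▹ z) (D.ax u (v ⋄ w') z)).inv
          (u ◃ D.ax v w' z) ⟫
        D.fb (D.fb (D.dwr ((u ⋄ v) ◃ x) (D.ax u v w') z).inv (D.ax u (v ⋄ w') z))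
          (u ◃ D.ax v w' z) ⟫
        D.fb (D.fb (D.hr (D.pr u v x).hom z) (D.ax u (v ⋄ w') z)) (u ◃ D.ax v w' z) ⟫
        D.fb (D.fb (D.dwr (D.ax u v w) (u ◃ v ◃ x) z).hom (D.ax u (v ⋄ w') z))
          (u ◃ D.ax v w' z) ⟫
        D.fb (D.ay (D.ax u v w ▹ z) ((u ◃ v ◃ x) ▹ z) (D.ax u (v ⋄ w') z)).hom
          (u ◃ D.ax v w' z) ⟫
        D.fb (D.ft (D.ax u v w ▹ z) (D.pm u (v ◃ x) z).hom) (u ◃ D.ax v w' z) ⟫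
        D.fb (D.ay (D.ax u v w ▹ z) (D.ax u (v ⋄ w) z) (u ◃ ((v ◃ x) ▹ z))).inv
          (u ◃ D.ax v w' z) ⟫
        (D.ay (D.ax u v w ▹ z ⊙ D.ax u (v ⋄ w) z) (u ◃ ((v ◃ x) ▹ z)) (u ◃ D.ax v w' z)).hom ⟫
        D.ft (D.ax u v w ▹ z ⊙ D.ax u (v ⋄ w) z) (D.dwl u ((v ◃ x) ▹ z) (D.ax v w' z)).inv ⟫
        D.ft (D.ax u v w ▹ z ⊙ D.ax u (v ⋄ w) z) (D.hl u (D.pm v x z).hom) ⟫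
        D.ft (D.ax u v w ▹ z ⊙ D.ax u (v ⋄ w) z) (D.dwl u (D.ax v w z) (v ◃ (x ▹ z))).hom ⟫
        (D.ay (D.ax u v w ▹ z ⊙ D.ax u (v ⋄ w) z) (u ◃ D.ax v w z) (u ◃ v ◃ (x ▹ z))).inv ⟫
        D.fb (D.pn u v w z).inv (u ◃ v ◃ (x ▹ z))
  /-- u | v | w | y | z -/
  ax17 : ∀ {a b c d e f : G.T0} (u : G.One a b) (v : G.One b c) (w : G.One c d) (y : G.One d e)
    (z : G.One e f),
    D.fb (D.fb (D.hr (D.pn u v w y).inv z) (D.ax u (v ⋄ (w ⋄ y)) z))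
          (u ◃ D.ax v (w ⋄ y) z ⊙ u ◃ v ◃ D.ax w y z) ⟫
        D.fb (D.fb (D.dwr (D.ax (u ⋄ v) w y) (D.ax u v (w ⋄ y)) z).hom (D.ax u (v ⋄ (w ⋄ y)) z))
          (u ◃ D.ax v (w ⋄ y) z ⊙ u ◃ v ◃ D.ax w y z) ⟫
        D.fb (D.ay (D.ax (u ⋄ v) w y ▹ z) (D.ax u v (w ⋄ y) ▹ z) (D.ax u (v ⋄ (w ⋄ y)) z)).hom
          (u ◃ D.ax v (w ⋄ y) z ⊙ u ◃ v ◃ D.ax w y z) ⟫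
        (D.ay (D.ax (u ⋄ v) w y ▹ z) (D.ax u v (w ⋄ y) ▹ z ⊙ D.ax u (v ⋄ (w ⋄ y)) z)
          (u ◃ D.ax v (w ⋄ y) z ⊙ u ◃ v ◃ D.ax w y z)).hom ⟫
        D.ft (D.ax (u ⋄ v) w y ▹ z) (D.ay (D.ax u v (w ⋄ y) ▹ z ⊙ D.ax u (v ⋄ (w ⋄ y)) z)
          (u ◃ D.ax v (w ⋄ y) z) (u ◃ v ◃ D.ax w y z)).inv ⟫
        D.ft (D.ax (u ⋄ v) w y ▹ z) (D.fb (D.pn u v (w ⋄ y) z).inv (u ◃ v ◃ D.ax w y z)) ⟫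
        D.ft (D.ax (u ⋄ v) w y ▹ z) (D.ay (D.ax (u ⋄ v) (w ⋄ y) z) (D.ax u v (w ⋄ y ⋄ z))
          (u ◃ v ◃ D.ax w y z)).hom ⟫
        D.ft (D.ax (u ⋄ v) w y ▹ z) (D.ft (D.ax (u ⋄ v) (w ⋄ y) z)
          (D.pr u v (D.ax w y z)).inv) ⟫
        D.ft (D.ax (u ⋄ v) w y ▹ z) (D.ay (D.ax (u ⋄ v) (w ⋄ y) z) ((u ⋄ v) ◃ D.ax w y z)
          (D.ax u v (w ⋄ (y ⋄ z)))).inv ⟫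
        (D.ay (D.ax (u ⋄ v) w y ▹ z) (D.ax (u ⋄ v) (w ⋄ y) z ⊙ (u ⋄ v) ◃ D.ax w y z)
          (D.ax u v (w ⋄ (y ⋄ z)))).inv ⟫
        D.fb (D.ay (D.ax (u ⋄ v) w y ▹ z) (D.ax (u ⋄ v) (w ⋄ y) z) ((u ⋄ v) ◃ D.ax w y z)).inv
          (D.ax u v (w ⋄ (y ⋄ z))) ⟫
        D.fb (D.pn (u ⋄ v) w y z).inv (D.ax u v (w ⋄ (y ⋄ z))) =
      D.fb (D.fb (D.dwr (D.ax u v w ▹ y ⊙ D.ax u (v ⋄ w) y) (u ◃ D.ax v w y) z).hom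
          (D.ax u (v ⋄ (w ⋄ y)) z)) (u ◃ D.ax v (w ⋄ y) z ⊙ u ◃ v ◃ D.ax w y z) ⟫
        D.fb (D.fb (D.fb (D.dwr (D.ax u v w ▹ y) (D.ax u (v ⋄ w) y) z).hom
          ((u ◃ D.ax v w y) ▹ z)) (D.ax u (v ⋄ (w ⋄ y)) z))
          (u ◃ D.ax v (w ⋄ y) z ⊙ u ◃ v ◃ D.ax w y z) ⟫
        D.fb (D.ay (D.ax u v w ▹ y ▹ z ⊙ D.ax u (v ⋄ w) y ▹ z) ((u ◃ D.ax v w y) ▹ z)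
          (D.ax u (v ⋄ (w ⋄ y)) z)).hom (u ◃ D.ax v (w ⋄ y) z ⊙ u ◃ v ◃ D.ax w y z) ⟫
        D.fb (D.ft (D.ax u v w ▹ y ▹ z ⊙ D.ax u (v ⋄ w) y ▹ z) (D.pm u (D.ax v w y) z).hom)
          (u ◃ D.ax v (w ⋄ y) z ⊙ u ◃ v ◃ D.ax w y z) ⟫
        D.fb (D.ay (D.ax u v w ▹ y ▹ z ⊙ D.ax u (v ⋄ w) y ▹ z) (D.ax u (v ⋄ w ⋄ y) z)
          (u ◃ (D.ax v w y ▹ z))).inv (u ◃ D.ax v (w ⋄ y) z ⊙ u ◃ v ◃ D.ax w y z) ⟫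
        (D.ay (D.ax u v w ▹ y ▹ z ⊙ D.ax u (v ⋄ w) y ▹ z ⊙ D.ax u (v ⋄ w ⋄ y) z)
          (u ◃ (D.ax v w y ▹ z)) (u ◃ D.ax v (w ⋄ y) z ⊙ u ◃ v ◃ D.ax w y z)).hom ⟫
        D.ft (D.ax u v w ▹ y ▹ z ⊙ D.ax u (v ⋄ w) y ▹ z ⊙ D.ax u (v ⋄ w ⋄ y) z)
          (D.ay (u ◃ (D.ax v w y ▹ z)) (u ◃ D.ax v (w ⋄ y) z) (u ◃ v ◃ D.ax w y z)).inv ⟫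
        D.ft (D.ax u v w ▹ y ▹ z ⊙ D.ax u (v ⋄ w) y ▹ z ⊙ D.ax u (v ⋄ w ⋄ y) z)
          (D.fb (D.dwl u (D.ax v w y ▹ z) (D.ax v (w ⋄ y) z)).inv (u ◃ v ◃ D.ax w y z)) ⟫
        D.ft (D.ax u v w ▹ y ▹ z ⊙ D.ax u (v ⋄ w) y ▹ z ⊙ D.ax u (v ⋄ w ⋄ y) z)
          (D.dwl u (D.ax v w y ▹ z ⊙ D.ax v (w ⋄ y) z) (v ◃ D.ax w y z)).inv ⟫
        D.ft (D.ax u v w ▹ y ▹ z ⊙ D.ax u (v ⋄ w) y ▹ z ⊙ D.ax u (v ⋄ w ⋄ y) z)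
          (D.hl u (D.pn v w y z).inv) ⟫
        D.ft (D.ax u v w ▹ y ▹ z ⊙ D.ax u (v ⋄ w) y ▹ z ⊙ D.ax u (v ⋄ w ⋄ y) z)
          (D.dwl u (D.ax (v ⋄ w) y z) (D.ax v w (y ⋄ z))).hom ⟫
        (D.ay (D.ax u v w ▹ y ▹ z ⊙ D.ax u (v ⋄ w) y ▹ z ⊙ D.ax u (v ⋄ w ⋄ y) z)
          (u ◃ D.ax (v ⋄ w) y z) (u ◃ D.ax v w (y ⋄ z))).inv ⟫
        D.fb (D.fb (D.ay (D.ax u v w ▹ y ▹ z) (D.ax u (v ⋄ w) y ▹ z)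
          (D.ax u (v ⋄ w ⋄ y) z)).hom (u ◃ D.ax (v ⋄ w) y z)) (u ◃ D.ax v w (y ⋄ z)) ⟫
        D.fb (D.ay (D.ax u v w ▹ y ▹ z) (D.ax u (v ⋄ w) y ▹ z ⊙ D.ax u (v ⋄ w ⋄ y) z)
          (u ◃ D.ax (v ⋄ w) y z)).hom (u ◃ D.ax v w (y ⋄ z)) ⟫
        D.fb (D.ft (D.ax u v w ▹ y ▹ z) (D.pn u (v ⋄ w) y z).inv) (u ◃ D.ax v w (y ⋄ z)) ⟫
        D.fb (D.ay (D.ax u v w ▹ y ▹ z) (D.ax (u ⋄ (v ⋄ w)) y z)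
          (D.ax u (v ⋄ w) (y ⋄ z))).inv (u ◃ D.ax v w (y ⋄ z)) ⟫
        D.fb (D.fb (D.pl (D.ax u v w) y z).hom (D.ax u (v ⋄ w) (y ⋄ z)))
          (u ◃ D.ax v w (y ⋄ z)) ⟫
        D.fb (D.ay (D.ax (u ⋄ v ⋄ w) y z) (D.ax u v w ▹ (y ⋄ z))
          (D.ax u (v ⋄ w) (y ⋄ z))).hom (u ◃ D.ax v w (y ⋄ z)) ⟫
        (D.ay (D.ax (u ⋄ v ⋄ w) y z) (D.ax u v w ▹ (y ⋄ z) ⊙ D.ax u (v ⋄ w) (y ⋄ z))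
          (u ◃ D.ax v w (y ⋄ z))).hom ⟫
        D.ft (D.ax (u ⋄ v ⋄ w) y z) (D.pn u v w (y ⋄ z)).inv ⟫
        (D.ay (D.ax (u ⋄ v ⋄ w) y z) (D.ax (u ⋄ v) w (y ⋄ z)) (D.ax u v (w ⋄ (y ⋄ z)))).inv
  /-- 1 | i -/
  ax18 : ∀ {a b : G.T0} (u : G.One a b),
    (D.pir (D.iy u)).hom ⟫ (D.ib (D.ir u)).hom =
      D.fb (D.evr u (D.ix b)).hom (D.ir u) ⟫ (D.it (D.ir u)).hom
  /-- i | 1 -/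
  ax18x : ∀ {a b : G.T0} (u : G.One a b),
    (D.pil (D.iy u)).hom ⟫ (D.ib (D.il u)).hom =
      D.fb (D.evl (D.ix a) u).hom (D.il u) ⟫ (D.it (D.il u)).hom
  /-- x y | i -/
  ax19 : ∀ {a b : G.T0} {u u' u'' : G.One a b} (x : G.Two u u') (y : G.Two u' u''),
    (D.pir (x ⊙ y)).hom =
      D.fb (D.dwr x y (D.ix b)).hom (D.ir u'') ⟫
        (D.ay (x ▹ D.ix b) (y ▹ D.ix b) (D.ir u'')).hom ⟫ D.ft (x ▹ D.ix b) (D.pir y).hom ⟫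
        (D.ay (x ▹ D.ix b) (D.ir u') y).inv ⟫ D.fb (D.pir x).hom y ⟫ (D.ay (D.ir u) x y).hom
  /-- i | x y -/
  ax19x : ∀ {a b : G.T0} {u u' u'' : G.One a b} (x : G.Two u u') (y : G.Two u' u''),
    (D.pil (x ⊙ y)).hom =
      D.fb (D.dwl (D.ix a) x y).hom (D.il u'') ⟫
        (D.ay (D.ix a ◃ x) (D.ix a ◃ y) (D.il u'')).hom ⟫ D.ft (D.ix a ◃ x) (D.pil y).hom ⟫
        (D.ay (D.ix a ◃ x) (D.il u') y).inv ⟫ D.fb (D.pil x).hom y ⟫ (D.ay (D.il u) x y).hom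
  /-- x | i | w -/
  ax20 : ∀ {a b c : G.T0} {u u' : G.One a b} (x : G.Two u u') (w : G.One b c),
    (D.dwr (x ▹ D.ix b) (D.ir u') w).hom ⟫ D.ft (x ▹ D.ix b ▹ w) (D.fp u' w).hom ⟫
        (D.ay (x ▹ D.ix b ▹ w) (D.ax u' (D.ix b) w) (u' ◃ D.il w)).inv ⟫
        D.fb (D.pl x (D.ix b) w).hom (u' ◃ D.il w) ⟫
        (D.ay (D.ax u (D.ix b) w) (x ▹ (D.ix b ⋄ w)) (u' ◃ D.il w)).hom ⟫
        D.ft (D.ax u (D.ix b) w) (D.sw x (D.il w)).hom =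
      D.hr (D.pir x).hom w ⟫ (D.dwr (D.ir u) x w).hom ⟫ D.fb (D.fp u w).hom (x ▹ w) ⟫
        (D.ay (D.ax u (D.ix b) w) (u ◃ D.il w) (x ▹ w)).hom
  /-- u | i | y -/
  ax20x : ∀ {a b c : G.T0} (u : G.One a b) {v v' : G.One b c} (y : G.Two v v'),
    D.ft (D.ax u (D.ix b) v) (D.hl u (D.pil y).hom) ⟫
        D.ft (D.ax u (D.ix b) v) (D.dwl u (D.il v) y).hom ⟫
        (D.ay (D.ax u (D.ix b) v) (u ◃ D.il v) (u ◃ y)).inv ⟫ D.fb (D.fp u v).inv (u ◃ y) =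
      D.ft (D.ax u (D.ix b) v) (D.dwl u (D.ix b ◃ y) (D.il v')).hom ⟫
        (D.ay (D.ax u (D.ix b) v) (u ◃ D.ix b ◃ y) (u ◃ D.il v')).inv ⟫
        D.fb (D.pr u (D.ix b) y).inv (u ◃ D.il v') ⟫
        (D.ay ((u ⋄ D.ix b) ◃ y) (D.ax u (D.ix b) v') (u ◃ D.il v')).hom ⟫
        D.ft ((u ⋄ D.ix b) ◃ y) (D.fp u v').inv ⟫ (D.sw (D.ir u) y).inv
  /-- x | v | i -/
  ax21 : ∀ {a b c : G.T0} {u u' : G.One a b} (x : G.Two u u') (v : G.One b c),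
    D.ft (D.ax u v (D.ix c)) (D.sw x (D.ir v)).hom ⟫
        (D.ay (D.ax u v (D.ix c)) (u ◃ D.ir v) (x ▹ v)).inv ⟫ D.fb (D.eri u v).hom (x ▹ v) =
      (D.ay (D.ax u v (D.ix c)) (x ▹ (v ⋄ D.ix c)) (u' ◃ D.ir v)).inv ⟫
        D.fb (D.pl x v (D.ix c)).inv (u' ◃ D.ir v) ⟫
        (D.ay (x ▹ v ▹ D.ix c) (D.ax u' v (D.ix c)) (u' ◃ D.ir v)).hom ⟫
        D.ft (x ▹ v ▹ D.ix c) (D.eri u' v).hom ⟫ (D.pir (x ▹ v)).hom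
  /-- i | u | y -/
  ax21x : ∀ {a b c : G.T0} (u : G.One a b) {v v' : G.One b c} (y : G.Two v v'),
    (D.sw (D.il u) y).hom ⟫ D.ft ((D.ix a ⋄ u) ◃ y) (D.eli u v').hom ⟫
        (D.ay ((D.ix a ⋄ u) ◃ y) (D.ax (D.ix a) u v') (D.il (u ⋄ v'))).inv ⟫
        D.fb (D.pr (D.ix a) u y).hom (D.il (u ⋄ v')) ⟫
        (D.ay (D.ax (D.ix a) u v) (D.ix a ◃ u ◃ y) (D.il (u ⋄ v'))).hom ⟫
        D.ft (D.ax (D.ix a) u v) (D.pil (u ◃ y)).hom =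
      D.fb (D.eli u v).hom (u ◃ y) ⟫ (D.ay (D.ax (D.ix a) u v) (D.il (u ⋄ v)) (u ◃ y)).hom
  /-- i | x | w -/
  ax22 : ∀ {a b c : G.T0} {u u' : G.One a b} (x : G.Two u u') (w : G.One b c),
    (D.dwr (D.ix a ◃ x) (D.il u') w).hom ⟫ D.ft ((D.ix a ◃ x) ▹ w) (D.eli u' w).hom ⟫
        (D.ay ((D.ix a ◃ x) ▹ w) (D.ax (D.ix a) u' w) (D.il (u' ⋄ w))).inv ⟫
        D.fb (D.pm (D.ix a) x w).hom (D.il (u' ⋄ w)) ⟫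
        (D.ay (D.ax (D.ix a) u w) (D.ix a ◃ (x ▹ w)) (D.il (u' ⋄ w))).hom ⟫
        D.ft (D.ax (D.ix a) u w) (D.pil (x ▹ w)).hom =
      D.hr (D.pil x).hom w ⟫ (D.dwr (D.il u) x w).hom ⟫ D.fb (D.eli u w).hom (x ▹ w) ⟫
        (D.ay (D.ax (D.ix a) u w) (D.il (u ⋄ w)) (x ▹ w)).hom
  /-- u | x | i -/
  ax22x : ∀ {a b c : G.T0} (u : G.One a b) {v v' : G.One b c} (x : G.Two v v'),
    D.ft (D.ax u v (D.ix c)) (D.dwl u (x ▹ D.ix c) (D.ir v')).hom ⟫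
        (D.ay (D.ax u v (D.ix c)) (u ◃ (x ▹ D.ix c)) (u ◃ D.ir v')).inv ⟫
        D.fb (D.pm u x (D.ix c)).inv (u ◃ D.ir v') ⟫
        (D.ay ((u ◃ x) ▹ D.ix c) (D.ax u v' (D.ix c)) (u ◃ D.ir v')).hom ⟫
        D.ft ((u ◃ x) ▹ D.ix c) (D.eri u v').hom ⟫ (D.pir (u ◃ x)).hom =
      D.ft (D.ax u v (D.ix c)) (D.hl u (D.pir x).hom) ⟫
        D.ft (D.ax u v (D.ix c)) (D.dwl u (D.ir v) x).hom ⟫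
        (D.ay (D.ax u v (D.ix c)) (u ◃ D.ir v) (u ◃ x)).inv ⟫ D.fb (D.eri u v).hom (u ◃ x)
  /-- i | i | w -/
  ax23 : ∀ {a b : G.T0} (w : G.One a b),
    D.fb (D.hr (D.sp a).hom w) (D.il w) ⟫ D.fb (D.fp (D.ix a) w).hom (D.il w) ⟫
        (D.ay (D.ax (D.ix a) (D.ix a) w) (D.ix a ◃ D.il w) (D.il w)).hom ⟫
        D.ft (D.ax (D.ix a) (D.ix a) w) (D.pil (D.il w)).hom =
      D.fb (D.eli (D.ix a) w).hom (D.il w) ⟫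
        (D.ay (D.ax (D.ix a) (D.ix a) w) (D.il (D.ix a ⋄ w)) (D.il w)).hom
  /-- u | i | i -/
  ax23x : ∀ {a b : G.T0} (u : G.One a b),
    D.ft (D.ax u (D.ix b) (D.ix b)) (D.fb (D.hl u (D.sp b).hom) (D.ir u)) ⟫
        (D.ay (D.ax u (D.ix b) (D.ix b)) (u ◃ D.ir (D.ix b)) (D.ir u)).inv ⟫
        D.fb (D.eri u (D.ix b)).hom (D.ir u) =
      (D.ay (D.ax u (D.ix b) (D.ix b)) (u ◃ D.il (D.ix b)) (D.ir u)).inv ⟫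
        D.fb (D.fp u (D.ix b)).inv (D.ir u) ⟫ (D.pir (D.ir u)).hom
  /-- i | u | i -/
  ax24 : ∀ {a b : G.T0} (u : G.One a b),
    D.fb (D.eli u (D.ix b)).hom (D.ir u) ⟫
        (D.ay (D.ax (D.ix a) u (D.ix b)) (D.il (u ⋄ D.ix b)) (D.ir u)).hom ⟫
        D.ft (D.ax (D.ix a) u (D.ix b)) (D.pil (D.ir u)).inv ⟫
        (D.ay (D.ax (D.ix a) u (D.ix b)) (D.ix a ◃ D.ir u) (D.il u)).inv ⟫
        D.fb (D.eri (D.ix a) u).hom (D.il u) =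
      (D.pir (D.il u)).hom
  /-- i | u | v | w -/
  ax25 : ∀ {a b c d : G.T0} (u : G.One a b) (v : G.One b c) (w : G.One c d),
    (D.pl (D.il u) v w).hom ⟫ D.ft (D.ax (D.ix a ⋄ u) v w) (D.eli u (v ⋄ w)).hom ⟫
        (D.ay (D.ax (D.ix a ⋄ u) v w) (D.ax (D.ix a) u (v ⋄ w)) (D.il (u ⋄ (v ⋄ w)))).inv =
      D.fb (D.hr (D.eli u v).hom w) (D.ax u v w) ⟫
        D.fb (D.dwr (D.ax (D.ix a) u v) (D.il (u ⋄ v)) w).hom (D.ax u v w) ⟫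
        D.fb (D.ft (D.ax (D.ix a) u v ▹ w) (D.eli (u ⋄ v) w).hom) (D.ax u v w) ⟫
        D.fb (D.ay (D.ax (D.ix a) u v ▹ w) (D.ax (D.ix a) (u ⋄ v) w) (D.il (u ⋄ v ⋄ w))).inv
          (D.ax u v w) ⟫
        (D.ay (D.ax (D.ix a) u v ▹ w ⊙ D.ax (D.ix a) (u ⋄ v) w) (D.il (u ⋄ v ⋄ w))
          (D.ax u v w)).hom ⟫
        D.ft (D.ax (D.ix a) u v ▹ w ⊙ D.ax (D.ix a) (u ⋄ v) w) (D.pil (D.ax u v w)).inv ⟫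
        (D.ay (D.ax (D.ix a) u v ▹ w ⊙ D.ax (D.ix a) (u ⋄ v) w) (D.ix a ◃ D.ax u v w)
          (D.il (u ⋄ (v ⋄ w)))).inv ⟫
        D.fb (D.pn (D.ix a) u v w).inv (D.il (u ⋄ (v ⋄ w)))
  /-- u | v | w | i -/
  ax25x : ∀ {a b c d : G.T0} (u : G.One a b) (v : G.One b c) (w : G.One c d),
    D.fb (D.pn u v w (D.ix d)).inv (u ◃ v ◃ D.ir w) ⟫
        (D.ay (D.ax (u ⋄ v) w (D.ix d)) (D.ax u v (w ⋄ D.ix d)) (u ◃ v ◃ D.ir w)).hom ⟫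
        D.ft (D.ax (u ⋄ v) w (D.ix d)) (D.pr u v (D.ir w)).inv ⟫
        (D.ay (D.ax (u ⋄ v) w (D.ix d)) ((u ⋄ v) ◃ D.ir w) (D.ax u v w)).inv ⟫
        D.fb (D.eri (u ⋄ v) w).hom (D.ax u v w) =
      (D.ay (D.ax u v w ▹ D.ix d ⊙ D.ax u (v ⋄ w) (D.ix d)) (u ◃ D.ax v w (D.ix d))
          (u ◃ v ◃ D.ir w)).hom ⟫
        D.ft (D.ax u v w ▹ D.ix d ⊙ D.ax u (v ⋄ w) (D.ix d))
          (D.dwl u (D.ax v w (D.ix d)) (v ◃ D.ir w)).inv ⟫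
        D.ft (D.ax u v w ▹ D.ix d ⊙ D.ax u (v ⋄ w) (D.ix d)) (D.hl u (D.eri v w).hom) ⟫
        (D.ay (D.ax u v w ▹ D.ix d) (D.ax u (v ⋄ w) (D.ix d)) (u ◃ D.ir (v ⋄ w))).hom ⟫
        D.ft (D.ax u v w ▹ D.ix d) (D.eri u (v ⋄ w)).hom ⟫ (D.pir (D.ax u v w)).hom
  /-- u | i | v | w -/
  ax26 : ∀ {a b c d : G.T0} (u : G.One a b) (v : G.One b c) (w : G.One c d),
    (D.pl (D.ir u) v w).hom ⟫ D.ft (D.ax (u ⋄ D.ix b) v w) (D.fp u (v ⋄ w)).hom ⟫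
        (D.ay (D.ax (u ⋄ D.ix b) v w) (D.ax u (D.ix b) (v ⋄ w)) (u ◃ D.il (v ⋄ w))).inv =
      D.fb (D.hr (D.fp u v).hom w) (D.ax u v w) ⟫
        D.fb (D.dwr (D.ax u (D.ix b) v) (u ◃ D.il v) w).hom (D.ax u v w) ⟫
        (D.ay (D.ax u (D.ix b) v ▹ w) ((u ◃ D.il v) ▹ w) (D.ax u v w)).hom ⟫
        D.ft (D.ax u (D.ix b) v ▹ w) (D.pm u (D.il v) w).hom ⟫
        (D.ay (D.ax u (D.ix b) v ▹ w) (D.ax u (D.ix b ⋄ v) w) (u ◃ (D.il v ▹ w))).inv ⟫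
        D.ft (D.ax u (D.ix b) v ▹ w ⊙ D.ax u (D.ix b ⋄ v) w) (D.hl u (D.eli v w).hom) ⟫
        D.ft (D.ax u (D.ix b) v ▹ w ⊙ D.ax u (D.ix b ⋄ v) w)
          (D.dwl u (D.ax (D.ix b) v w) (D.il (v ⋄ w))).hom ⟫
        (D.ay (D.ax u (D.ix b) v ▹ w ⊙ D.ax u (D.ix b ⋄ v) w) (u ◃ D.ax (D.ix b) v w)
          (u ◃ D.il (v ⋄ w))).inv ⟫
        D.fb (D.pn u (D.ix b) v w).inv (u ◃ D.il (v ⋄ w))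
  /-- u | v | i | w -/
  ax26x : ∀ {a b c d : G.T0} (u : G.One a b) (v : G.One b c) (w : G.One c d),
    D.fb (D.pn u v (D.ix c) w).inv (u ◃ v ◃ D.il w) ⟫
        (D.ay (D.ax (u ⋄ v) (D.ix c) w) (D.ax u v (D.ix c ⋄ w)) (u ◃ v ◃ D.il w)).hom ⟫
        D.ft (D.ax (u ⋄ v) (D.ix c) w) (D.pr u v (D.il w)).inv ⟫
        (D.ay (D.ax (u ⋄ v) (D.ix c) w) ((u ⋄ v) ◃ D.il w) (D.ax u v w)).inv ⟫
        D.fb (D.fp (u ⋄ v) w).inv (D.ax u v w) =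
      (D.ay (D.ax u v (D.ix c) ▹ w ⊙ D.ax u (v ⋄ D.ix c) w) (u ◃ D.ax v (D.ix c) w)
          (u ◃ v ◃ D.il w)).hom ⟫
        D.ft (D.ax u v (D.ix c) ▹ w ⊙ D.ax u (v ⋄ D.ix c) w)
          (D.dwl u (D.ax v (D.ix c) w) (v ◃ D.il w)).inv ⟫
        D.ft (D.ax u v (D.ix c) ▹ w ⊙ D.ax u (v ⋄ D.ix c) w) (D.hl u (D.fp v w).inv) ⟫
        (D.ay (D.ax u v (D.ix c) ▹ w) (D.ax u (v ⋄ D.ix c) w) (u ◃ (D.ir v ▹ w))).hom ⟫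
        D.ft (D.ax u v (D.ix c) ▹ w) (D.pm u (D.ir v) w).inv ⟫
        (D.ay (D.ax u v (D.ix c) ▹ w) ((u ◃ D.ir v) ▹ w) (D.ax u v w)).inv ⟫
        D.fb (D.dwr (D.ax u v (D.ix c)) (u ◃ D.ir v) w).inv (D.ax u v w) ⟫
        D.fb (D.hr (D.eri u v).hom w) (D.ax u v w)

/-- The axiom groups 27 to 41 and their reflections. -/
structure TricatData.SpatialAxioms : Prop where
  ax27 : ∀ {a b : G.T0} {u v : G.One a b} {x y : G.Two u v} (f : G.Three x y), D.iz x ⟫ f = f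
  ax27z : ∀ {a b : G.T0} {u v : G.One a b} {x y : G.Two u v} (f : G.Three x y), f ⟫ D.iz y = f
  ax28 : ∀ {a b : G.T0} {u v : G.One a b} {x y z t : G.Two u v} (f : G.Three x y)
    (g : G.Three y z) (h : G.Three z t), (f ⟫ g) ⟫ h = f ⟫ (g ⟫ h)
  ax29 : ∀ {a b : G.T0} {u v w : G.One a b} (x : G.Two u v) (y : G.Two v w),
    D.fb (D.iz x) y = D.iz (x ⊙ y)
  ax29y : ∀ {a b : G.T0} {u v w : G.One a b} (x : G.Two u v) (y : G.Two v w),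
    D.ft x (D.iz y) = D.iz (x ⊙ y)
  ax30 : ∀ {a b : G.T0} {u v : G.One a b} {x x' : G.Two u v} (f : G.Three x x'),
    D.ft (D.iy u) f ⟫ (D.it x').hom = (D.it x).hom ⟫ f
  ax30y : ∀ {a b : G.T0} {u v : G.One a b} {x x' : G.Two u v} (f : G.Three x x'),
    D.fb f (D.iy v) ⟫ (D.ib x').hom = (D.ib x).hom ⟫ f
  ax31 : ∀ {a b : G.T0} {u v w : G.One a b} {x x' x'' : G.Two u v} (f : G.Three x x')
    (g : G.Three x' x'') (y : G.Two v w), D.fb (f ⟫ g) y = D.fb f y ⟫ D.fb g y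
  ax31y : ∀ {a b : G.T0} {u v w : G.One a b} (x : G.Two u v) {y y' y'' : G.Two v w}
    (f : G.Three y y') (g : G.Three y' y''), D.ft x (f ⟫ g) = D.ft x f ⟫ D.ft x g
  ax32 : ∀ {a b : G.T0} {u v w : G.One a b} {x x' : G.Two u v} {y y' : G.Two v w}
    (f : G.Three x x') (g : G.Three y y'), D.ft x g ⟫ D.fb f y' = D.fb f y ⟫ D.ft x' g
  ax33 : ∀ {a b : G.T0} {u v w z : G.One a b} {x x' : G.Two u v} (f : G.Three x x')
    (y : G.Two v w) (r : G.Two w z),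
    D.fb (D.fb f y) r ⟫ (D.ay x' y r).hom = (D.ay x y r).hom ⟫ D.fb f (y ⊙ r)
  ax33y : ∀ {a b : G.T0} {u v w z : G.One a b} (x : G.Two u v) (y : G.Two v w)
    {r r' : G.Two w z} (f : G.Three r r'),
    D.ft (x ⊙ y) f ⟫ (D.ay x y r').hom = (D.ay x y r).hom ⟫ D.ft x (D.ft y f)
  ax34 : ∀ {a b : G.T0} {u v w z : G.One a b} (x : G.Two u v) {y y' : G.Two v w}
    (f : G.Three y y') (r : G.Two w z),
    D.fb (D.ft x f) r ⟫ (D.ay x y' r).hom = (D.ay x y r).hom ⟫ D.ft x (D.fb f r)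
  ax35 : ∀ {a b c : G.T0} {u u' : G.One a b} (x : G.Two u u') (v : G.One b c),
    D.hr (D.iz x) v = D.iz (x ▹ v)
  ax35x : ∀ {a b c : G.T0} (v : G.One a b) {u u' : G.One b c} (x : G.Two u u'),
    D.hl v (D.iz x) = D.iz (v ◃ x)
  ax36 : ∀ {a b : G.T0} {u u' : G.One a b} {x x' : G.Two u u'} (f : G.Three x x'),
    D.fb (D.hr f (D.ix b)) (D.ir u') ⟫ (D.pir x').hom = (D.pir x).hom ⟫ D.ft (D.ir u) f
  ax36x : ∀ {a b : G.T0} {u u' : G.One a b} {x x' : G.Two u u'} (f : G.Three x x'),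
    D.fb (D.hl (D.ix a) f) (D.il u') ⟫ (D.pil x').hom = (D.pil x).hom ⟫ D.ft (D.il u) f
  ax37 : ∀ {a b c : G.T0} {u u' : G.One a b} {v v' : G.One b c} {x x' : G.Two u u'}
    (f : G.Three x x') (y : G.Two v v'),
    D.fb (D.hr f v) (u' ◃ y) ⟫ (D.sw x' y).hom = (D.sw x y).hom ⟫ D.ft (u ◃ y) (D.hr f v')
  ax37x : ∀ {a b c : G.T0} {u u' : G.One a b} {v v' : G.One b c} (x : G.Two u u')
    {y y' : G.Two v v'} (f : G.Three y y'),
    D.ft (x ▹ v) (D.hl u' f) ⟫ (D.sw x y').hom = (D.sw x y).hom ⟫ D.fb (D.hl u f) (x ▹ v')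
  ax38 : ∀ {a b c : G.T0} {u u' : G.One a b} {x x' x'' : G.Two u u'} (f : G.Three x x')
    (g : G.Three x' x'') (v : G.One b c), D.hr (f ⟫ g) v = D.hr f v ⟫ D.hr g v
  ax38x : ∀ {a b c : G.T0} (v : G.One a b) {u u' : G.One b c} {x x' x'' : G.Two u u'}
    (f : G.Three x x') (g : G.Three x' x''), D.hl v (f ⟫ g) = D.hl v f ⟫ D.hl v g
  ax39 : ∀ {a b c : G.T0} {u u' u'' : G.One a b} {x x' : G.Two u u'} (f : G.Three x x')
    (y : G.Two u' u'') (v : G.One b c),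
    D.hr (D.fb f y) v ⟫ (D.dwr x' y v).hom = (D.dwr x y v).hom ⟫ D.fb (D.hr f v) (y ▹ v)
  ax39x : ∀ {a b c : G.T0} (v : G.One a b) {u u' u'' : G.One b c} {x x' : G.Two u u'}
    (f : G.Three x x') (y : G.Two u' u''),
    D.hl v (D.fb f y) ⟫ (D.dwl v x' y).hom = (D.dwl v x y).hom ⟫ D.fb (D.hl v f) (v ◃ y)
  ax39y : ∀ {a b c : G.T0} {u u' u'' : G.One a b} (x : G.Two u u') {y y' : G.Two u' u''}
    (f : G.Three y y') (v : G.One b c),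
    D.hr (D.ft x f) v ⟫ (D.dwr x y' v).hom = (D.dwr x y v).hom ⟫ D.ft (x ▹ v) (D.hr f v)
  ax39xy : ∀ {a b c : G.T0} (v : G.One a b) {u u' u'' : G.One b c} (x : G.Two u u')
    {y y' : G.Two u' u''} (f : G.Three y y'),
    D.hl v (D.ft x f) ⟫ (D.dwl v x y').hom = (D.dwl v x y).hom ⟫ D.ft (v ◃ x) (D.hl v f)
  ax40 : ∀ {a b c d : G.T0} {u u' : G.One a b} {x x' : G.Two u u'} (f : G.Three x x')
    (v : G.One b c) (w : G.One c d),
    D.fb (D.hr (D.hr f v) w) (D.ax u' v w) ⟫ (D.pl x' v w).hom =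
      (D.pl x v w).hom ⟫ D.ft (D.ax u v w) (D.hr f (v ⋄ w))
  ax40x : ∀ {a b c d : G.T0} (u : G.One a b) (v : G.One b c) {w w' : G.One c d}
    {x x' : G.Two w w'} (f : G.Three x x'),
    D.fb (D.hl (u ⋄ v) f) (D.ax u v w') ⟫ (D.pr u v x').hom =
      (D.pr u v x).hom ⟫ D.ft (D.ax u v w) (D.hl u (D.hl v f))
  ax41 : ∀ {a b c d : G.T0} (u : G.One a b) {v v' : G.One b c} {x x' : G.Two v v'}
    (f : G.Three x x') (w : G.One c d),
    D.fb (D.hr (D.hl u f) w) (D.ax u v' w) ⟫ (D.pm u x' w).hom =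
      (D.pm u x w).hom ⟫ D.ft (D.ax u v w) (D.hl u (D.hr f w))

end Axioms

/-- A tricategory with the given sets of cells. -/
structure Tricategory (G : CellSets.{u₀, u₁, u₂, u₃}) extends TricatData G where
  il_invertible : ∀ {a b : G.T0} (u : G.One a b), toTricatData.Invertible2 (il u)
  ir_invertible : ∀ {a b : G.T0} (u : G.One a b), toTricatData.Invertible2 (ir u)
  ax_invertible : ∀ {a b c d : G.T0} (u : G.One a b) (v : G.One b c) (w : G.One c d),
    toTricatData.Invertible2 (ax u v w)
  polygon : toTricatData.PolygonAxioms
  spatial : toTricatData.SpatialAxioms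


/-! ### Strict pullbacks of categories -/

/-- A morphism that is an identity morphism (of its source, which then equals its target). -/
def IsIdentity {C : Type u₀} [Category.{v₀} C] {X Y : C} (f : X ⟶ Y) : Prop :=
  ∃ h : X = Y, f = eqToHom h

namespace IsIdentity

variable {C : Type u₀} [Category.{v₀} C] {D : Type u₁} [Category.{v₁} D]

theorem of_id (X : C) : IsIdentity (𝟙 X) := ⟨rfl, rfl⟩

theorem of_eqToHom {X Y : C} (h : X = Y) : IsIdentity (eqToHom h) := ⟨h, rfl⟩

theorem comp {X Y Z : C} {f : X ⟶ Y} {g : Y ⟶ Z} (hf : IsIdentity f) (hg : IsIdentity g) :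
    IsIdentity (f ≫ g) := by
  obtain ⟨rfl, rfl⟩ := hf
  obtain ⟨rfl, rfl⟩ := hg
  exact ⟨rfl, by simp⟩

theorem map {X Y : C} {f : X ⟶ Y} (hf : IsIdentity f) (F : C ⥤ D) : IsIdentity (F.map f) := by
  obtain ⟨rfl, rfl⟩ := hf
  exact ⟨rfl, by simp⟩

theorem inv {X Y : C} (e : X ≅ Y) (h : IsIdentity e.hom) : IsIdentity e.inv := by
  obtain ⟨rfl, h⟩ := h
  refine ⟨rfl, ?_⟩
  have e' := e.hom_inv_id
  rw [h] at e'
  simpa using e'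

theorem of_eq {F F' : C ⥤ D} (h : F = F') {X Y : C} {f : X ⟶ Y} (hf : IsIdentity (F'.map f)) :
    IsIdentity (F.map f) := by
  subst h
  exact hf

end IsIdentity

/-- The strict pullback of two functors: the pullback in the 1-category of categories. -/
structure StrictPb {A : Type u₀} [Category.{v₀} A] {B : Type u₁} [Category.{v₁} B]
    {C : Type u₂} [Category.{v₂} C] (F : A ⥤ C) (G : B ⥤ C) where
  fst : A
  snd : B
  w : F.obj fst = G.obj snd

namespace StrictPb

variable {A : Type u₀} [Category.{v₀} A] {B : Type u₁} [Category.{v₁} B]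
  {C : Type u₂} [Category.{v₂} C] {X : Type w} [Category.{w'} X]

/-- A morphism of the strict pullback: a pair of morphisms with the same image. -/
@[ext] structure Hom {F : A ⥤ C} {G : B ⥤ C} (p q : StrictPb F G) where
  fst : p.fst ⟶ q.fst
  snd : p.snd ⟶ q.snd
  w : F.map fst ≫ eqToHom q.w = eqToHom p.w ≫ G.map snd

instance (F : A ⥤ C) (G : B ⥤ C) : Category (StrictPb F G) where
  Hom := Hom
  id p := ⟨𝟙 _, 𝟙 _, by simp⟩
  comp f g := ⟨f.fst ≫ g.fst, f.snd ≫ g.snd, by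
    rw [F.map_comp, G.map_comp, Category.assoc, g.w, ← Category.assoc, f.w, Category.assoc]⟩
  id_comp f := Hom.ext (Category.id_comp _) (Category.id_comp _)
  comp_id f := Hom.ext (Category.comp_id _) (Category.comp_id _)
  assoc f g h := Hom.ext (Category.assoc _ _ _) (Category.assoc _ _ _)

/-- The first projection. -/
def π₁ (F : A ⥤ C) (G : B ⥤ C) : StrictPb F G ⥤ A where
  obj p := p.fst
  map f := f.fst
  map_id _ := rfl
  map_comp _ _ := rfl

/-- The second projection. -/
def π₂ (F : A ⥤ C) (G : B ⥤ C) : StrictPb F G ⥤ B where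
  obj p := p.snd
  map f := f.snd
  map_id _ := rfl
  map_comp _ _ := rfl

theorem condition (F : A ⥤ C) (G : B ⥤ C) : π₁ F G ⋙ F = π₂ F G ⋙ G :=
  CategoryTheory.Functor.ext (fun p => p.w) (fun p q f => by
    have h := f.w
    change F.map f.fst = eqToHom p.w ≫ G.map f.snd ≫ eqToHom q.w.symm
    rw [← Category.assoc, ← h]
    simp)

/-- The functor to the pullback with given components. -/
def lift {F : A ⥤ C} {G : B ⥤ C} (H : X ⥤ A) (K : X ⥤ B) (h : H ⋙ F = K ⋙ G) :
    X ⥤ StrictPb F G where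
  obj x := ⟨H.obj x, K.obj x, Functor.congr_obj h x⟩
  map f := ⟨H.map f, K.map f, by
    have e := Functor.congr_hom h f
    dsimp at e
    simp [e]⟩
  map_id x := Hom.ext (H.map_id x) (K.map_id x)
  map_comp f g := Hom.ext (H.map_comp f g) (K.map_comp f g)

theorem lift_congr {F : A ⥤ C} {G : B ⥤ C} {H H' : X ⥤ A} {K K' : X ⥤ B} (e : H = H')
    (e' : K = K') (h' : H' ⋙ F = K' ⋙ G) :
    lift H K ((congrArg (· ⋙ F) e).trans (h'.trans (congrArg (· ⋙ G) e').symm)) =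
      lift H' K' h' := by
  subst e e'
  rfl

theorem isIdentity {F : A ⥤ C} {G : B ⥤ C} {p q : StrictPb F G} (f : p ⟶ q)
    (h₁ : IsIdentity f.fst) (h₂ : IsIdentity f.snd) : IsIdentity f := by
  obtain ⟨p₁, p₂, hp⟩ := p
  obtain ⟨q₁, q₂, hq⟩ := q
  obtain ⟨f₁, f₂, hf⟩ := f
  obtain ⟨e₁, h₁⟩ := h₁
  obtain ⟨e₂, h₂⟩ := h₂
  dsimp only at e₁ e₂ h₁ h₂
  subst e₁ e₂
  subst h₁ h₂
  exact ⟨rfl, rfl⟩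

end StrictPb

/-! ### Bicategory objects in the 2-category of categories -/

/-- The 0-data of a (not necessarily fibrant) bicategory object in the 2-category of categories. -/
structure CatCells where
  C0 : Type u₀
  C1 : Type u₁
  C2 : Type u₂
  [cat0 : Category.{v₀} C0]
  [cat1 : Category.{v₁} C1]
  [cat2 : Category.{v₂} C2]
  s1 : C1 ⥤ C0
  t1 : C1 ⥤ C0
  s2 : C2 ⥤ C1
  t2 : C2 ⥤ C1
  t2_s1 : t2 ⋙ s1 = s2 ⋙ s1
  t2_t1 : t2 ⋙ t1 = s2 ⋙ t1

attribute [instance] CatCells.cat0 CatCells.cat1 CatCells.cat2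

namespace CatCells

section Stage

variable (K : CatCells.{u₀, u₁, u₂, v₀, v₁, v₂}) {X : Type w} [Category.{w'} X]

/-- The functors `X ⥤ C1` whose composites with the source and target are `a` and `b`. -/
structure GOne (a b : X ⥤ K.C0) where
  val : X ⥤ K.C1
  src : val ⋙ K.s1 = a
  tgt : val ⋙ K.t1 = b

variable {a b : X ⥤ K.C0}

/-- The functors `X ⥤ C2` whose composites with the source and target are `U` and `V`. -/
structure GTwo (U V : K.GOne a b) where
  val : X ⥤ K.C2
  src : val ⋙ K.s2 = U.val
  tgt : val ⋙ K.t2 = V.val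

/-- The natural isomorphisms between two functors `X ⥤ C2` that are sent to identity natural
transformations by the source and the target functor. -/
structure GIso {U V : K.GOne a b} (x y : K.GTwo U V) where
  iso : x.val ≅ y.val
  src : ∀ p, IsIdentity (K.s2.map (iso.hom.app p))
  tgt : ∀ p, IsIdentity (K.t2.map (iso.hom.app p))

/-- A functor to `C1` with source `a`. -/
def oneOf {a : X ⥤ K.C0} (F : X ⥤ K.C1) (h : F ⋙ K.s1 = a) : K.GOne a (F ⋙ K.t1) := ⟨F, h, rfl⟩

/-- The source of a functor to `C2`, as a functor to `C1` with source `a`. -/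
def srcOf {a : X ⥤ K.C0} (F : X ⥤ K.C2) (h : F ⋙ K.s2 ⋙ K.s1 = a) :
    K.GOne a (F ⋙ K.s2 ⋙ K.t1) := ⟨F ⋙ K.s2, h, rfl⟩

/-- The target of a functor to `C2` with source `U`. -/
def tgtOf (U : K.GOne a b) (F : X ⥤ K.C2) (h : F ⋙ K.s2 = U.val) : K.GOne a b :=
  ⟨F ⋙ K.t2,
    (congrArg (F ⋙ ·) K.t2_s1).trans ((congrArg (· ⋙ K.s1) h).trans U.src),
    (congrArg (F ⋙ ·) K.t2_t1).trans ((congrArg (· ⋙ K.t1) h).trans U.tgt)⟩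

/-- A functor to `C2` with source `U`. -/
def twoOf (U : K.GOne a b) (F : X ⥤ K.C2) (h : F ⋙ K.s2 = U.val) : K.GTwo U (K.tgtOf U F h) :=
  ⟨F, h, rfl⟩

end Stage

section Domains

open StrictPb

variable (K : CatCells.{u₀, u₁, u₂, v₀, v₁, v₂})

/-- Pairs of horizontally composable 1-cells. -/
abbrev P11 := StrictPb K.t1 K.s1

/-- Pairs of vertically composable 2-cells. -/
abbrev P2v := StrictPb K.t2 K.s2

/-- Triples of vertically composable 2-cells. -/
abbrev P3v := StrictPb (π₂ K.t2 K.s2 ⋙ K.t2) K.s2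

/-- A 2-cell followed horizontally by a 1-cell. -/
abbrev P21 := StrictPb (K.s2 ⋙ K.t1) K.s1

/-- A 1-cell followed horizontally by a 2-cell. -/
abbrev P12 := StrictPb K.t1 (K.s2 ⋙ K.s1)

/-- Pairs of horizontally composable 2-cells. -/
abbrev P22 := StrictPb (K.s2 ⋙ K.t1) (K.s2 ⋙ K.s1)

/-- A vertically composable pair of 2-cells followed horizontally by a 1-cell. -/
abbrev P2v1 := StrictPb (π₁ K.t2 K.s2 ⋙ K.s2 ⋙ K.t1) K.s1

/-- A 1-cell followed horizontally by a vertically composable pair of 2-cells. -/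
abbrev P12v := StrictPb K.t1 (π₁ K.t2 K.s2 ⋙ K.s2 ⋙ K.s1)

/-- Triples of horizontally composable 1-cells. -/
abbrev P111 := StrictPb (π₂ K.t1 K.s1 ⋙ K.t1) K.s1

/-- A 2-cell followed horizontally by two 1-cells. -/
abbrev P211 := StrictPb (π₂ (K.s2 ⋙ K.t1) K.s1 ⋙ K.t1) K.s1

/-- A 1-cell, a 2-cell and a 1-cell, horizontally composable. -/
abbrev P121 := StrictPb (π₂ K.t1 (K.s2 ⋙ K.s1) ⋙ K.s2 ⋙ K.t1) K.s1

/-- Two 1-cells followed horizontally by a 2-cell. -/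
abbrev P112 := StrictPb (π₂ K.t1 K.s1 ⋙ K.t1) (K.s2 ⋙ K.s1)

/-- Quadruples of horizontally composable 1-cells. -/
abbrev P1111 := StrictPb (π₂ (π₂ K.t1 K.s1 ⋙ K.t1) K.s1 ⋙ K.t1) K.s1

/-! The universal cells on these domains. -/

def u1 := K.oneOf (𝟭 K.C1) rfl

def x2 := K.twoOf (K.srcOf (𝟭 K.C2) rfl) (𝟭 K.C2) rfl

def u11 := K.oneOf (π₁ K.t1 K.s1) rfl
def v11 := K.oneOf (π₂ K.t1 K.s1) (condition K.t1 K.s1).symm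

def x2v := K.twoOf (K.srcOf (π₁ K.t2 K.s2) rfl) (π₁ K.t2 K.s2) rfl
def y2v := K.twoOf (K.tgtOf (K.srcOf (π₁ K.t2 K.s2) rfl) (π₁ K.t2 K.s2) rfl) (π₂ K.t2 K.s2)
  (condition K.t2 K.s2).symm

/-- The projection from triples to the first two 2-cells. -/
abbrev q3v := π₁ (π₂ K.t2 K.s2 ⋙ K.t2) K.s2
def x3v := K.twoOf (K.srcOf (K.q3v ⋙ π₁ K.t2 K.s2) rfl) (K.q3v ⋙ π₁ K.t2 K.s2) rfl
def y3v := K.twoOf (K.tgtOf (K.srcOf (K.q3v ⋙ π₁ K.t2 K.s2) rfl) (K.q3v ⋙ π₁ K.t2 K.s2) rfl)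
  (K.q3v ⋙ π₂ K.t2 K.s2) (congrArg (K.q3v ⋙ ·) (condition K.t2 K.s2).symm)
def r3v := K.twoOf
  (K.tgtOf (K.tgtOf (K.srcOf (K.q3v ⋙ π₁ K.t2 K.s2) rfl) (K.q3v ⋙ π₁ K.t2 K.s2) rfl)
    (K.q3v ⋙ π₂ K.t2 K.s2) (congrArg (K.q3v ⋙ ·) (condition K.t2 K.s2).symm))
  (π₂ (π₂ K.t2 K.s2 ⋙ K.t2) K.s2) (condition (π₂ K.t2 K.s2 ⋙ K.t2) K.s2).symm

def x21 := K.twoOf (K.srcOf (π₁ (K.s2 ⋙ K.t1) K.s1) rfl) (π₁ (K.s2 ⋙ K.t1) K.s1) rfl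
def v21 := K.oneOf (π₂ (K.s2 ⋙ K.t1) K.s1) (condition (K.s2 ⋙ K.t1) K.s1).symm

def u12 := K.oneOf (π₁ K.t1 (K.s2 ⋙ K.s1)) rfl
def y12 := K.twoOf
  (K.srcOf (π₂ K.t1 (K.s2 ⋙ K.s1)) (condition K.t1 (K.s2 ⋙ K.s1)).symm)
  (π₂ K.t1 (K.s2 ⋙ K.s1)) rfl

def x22 := K.twoOf (K.srcOf (π₁ (K.s2 ⋙ K.t1) (K.s2 ⋙ K.s1)) rfl)
  (π₁ (K.s2 ⋙ K.t1) (K.s2 ⋙ K.s1)) rfl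
def y22 := K.twoOf
  (K.srcOf (π₂ (K.s2 ⋙ K.t1) (K.s2 ⋙ K.s1)) (condition (K.s2 ⋙ K.t1) (K.s2 ⋙ K.s1)).symm)
  (π₂ (K.s2 ⋙ K.t1) (K.s2 ⋙ K.s1)) rfl

/-- The projection to the vertically composable pair. -/
abbrev q2v1 := π₁ (π₁ K.t2 K.s2 ⋙ K.s2 ⋙ K.t1) K.s1
def x2v1 := K.twoOf (K.srcOf (K.q2v1 ⋙ π₁ K.t2 K.s2) rfl) (K.q2v1 ⋙ π₁ K.t2 K.s2) rfl
def y2v1 := K.twoOf (K.tgtOf (K.srcOf (K.q2v1 ⋙ π₁ K.t2 K.s2) rfl) (K.q2v1 ⋙ π₁ K.t2 K.s2) rfl)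
  (K.q2v1 ⋙ π₂ K.t2 K.s2) (congrArg (K.q2v1 ⋙ ·) (condition K.t2 K.s2).symm)
def v2v1 := K.oneOf (π₂ (π₁ K.t2 K.s2 ⋙ K.s2 ⋙ K.t1) K.s1)
  (condition (π₁ K.t2 K.s2 ⋙ K.s2 ⋙ K.t1) K.s1).symm

/-- The projection to the vertically composable pair. -/
abbrev q12v := π₂ K.t1 (π₁ K.t2 K.s2 ⋙ K.s2 ⋙ K.s1)
def u12v := K.oneOf (π₁ K.t1 (π₁ K.t2 K.s2 ⋙ K.s2 ⋙ K.s1)) rfl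
def x12v := K.twoOf
  (K.srcOf (K.q12v ⋙ π₁ K.t2 K.s2) (condition K.t1 (π₁ K.t2 K.s2 ⋙ K.s2 ⋙ K.s1)).symm)
  (K.q12v ⋙ π₁ K.t2 K.s2) rfl
def y12v := K.twoOf
  (K.tgtOf (K.srcOf (K.q12v ⋙ π₁ K.t2 K.s2) (condition K.t1 (π₁ K.t2 K.s2 ⋙ K.s2 ⋙ K.s1)).symm)
    (K.q12v ⋙ π₁ K.t2 K.s2) rfl)
  (K.q12v ⋙ π₂ K.t2 K.s2) (congrArg (K.q12v ⋙ ·) (condition K.t2 K.s2).symm)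

/-- The projection to the first two 1-cells. -/
abbrev q111 := π₁ (π₂ K.t1 K.s1 ⋙ K.t1) K.s1
def u111 := K.oneOf (K.q111 ⋙ π₁ K.t1 K.s1) rfl
def v111 := K.oneOf (K.q111 ⋙ π₂ K.t1 K.s1) (congrArg (K.q111 ⋙ ·) (condition K.t1 K.s1).symm)
def w111 := K.oneOf (π₂ (π₂ K.t1 K.s1 ⋙ K.t1) K.s1) (condition (π₂ K.t1 K.s1 ⋙ K.t1) K.s1).symm

/-- The projection to the 2-cell and the first 1-cell. -/
abbrev q211 := π₁ (π₂ (K.s2 ⋙ K.t1) K.s1 ⋙ K.t1) K.s1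
def x211 := K.twoOf (K.srcOf (K.q211 ⋙ π₁ (K.s2 ⋙ K.t1) K.s1) rfl)
  (K.q211 ⋙ π₁ (K.s2 ⋙ K.t1) K.s1) rfl
def v211 := K.oneOf (K.q211 ⋙ π₂ (K.s2 ⋙ K.t1) K.s1)
  (congrArg (K.q211 ⋙ ·) (condition (K.s2 ⋙ K.t1) K.s1).symm)
def w211 := K.oneOf (π₂ (π₂ (K.s2 ⋙ K.t1) K.s1 ⋙ K.t1) K.s1)
  (condition (π₂ (K.s2 ⋙ K.t1) K.s1 ⋙ K.t1) K.s1).symm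

/-- The projection to the first 1-cell and the 2-cell. -/
abbrev q121 := π₁ (π₂ K.t1 (K.s2 ⋙ K.s1) ⋙ K.s2 ⋙ K.t1) K.s1
def u121 := K.oneOf (K.q121 ⋙ π₁ K.t1 (K.s2 ⋙ K.s1)) rfl
def x121 := K.twoOf
  (K.srcOf (K.q121 ⋙ π₂ K.t1 (K.s2 ⋙ K.s1))
    (congrArg (K.q121 ⋙ ·) (condition K.t1 (K.s2 ⋙ K.s1)).symm))
  (K.q121 ⋙ π₂ K.t1 (K.s2 ⋙ K.s1)) rfl
def w121 := K.oneOf (π₂ (π₂ K.t1 (K.s2 ⋙ K.s1) ⋙ K.s2 ⋙ K.t1) K.s1)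
  (condition (π₂ K.t1 (K.s2 ⋙ K.s1) ⋙ K.s2 ⋙ K.t1) K.s1).symm

/-- The projection to the 1-cells. -/
abbrev q112 := π₁ (π₂ K.t1 K.s1 ⋙ K.t1) (K.s2 ⋙ K.s1)
def u112 := K.oneOf (K.q112 ⋙ π₁ K.t1 K.s1) rfl
def v112 := K.oneOf (K.q112 ⋙ π₂ K.t1 K.s1) (congrArg (K.q112 ⋙ ·) (condition K.t1 K.s1).symm)
def x112 := K.twoOf
  (K.srcOf (π₂ (π₂ K.t1 K.s1 ⋙ K.t1) (K.s2 ⋙ K.s1))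
    (condition (π₂ K.t1 K.s1 ⋙ K.t1) (K.s2 ⋙ K.s1)).symm)
  (π₂ (π₂ K.t1 K.s1 ⋙ K.t1) (K.s2 ⋙ K.s1)) rfl

/-- The projection to the first three 1-cells. -/
abbrev q1111 := π₁ (π₂ (π₂ K.t1 K.s1 ⋙ K.t1) K.s1 ⋙ K.t1) K.s1
def u1111 := K.oneOf (K.q1111 ⋙ K.q111 ⋙ π₁ K.t1 K.s1) rfl
def v1111 := K.oneOf (K.q1111 ⋙ K.q111 ⋙ π₂ K.t1 K.s1)
  (congrArg (fun F => K.q1111 ⋙ K.q111 ⋙ F) (condition K.t1 K.s1).symm)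
def w1111 := K.oneOf (K.q1111 ⋙ π₂ (π₂ K.t1 K.s1 ⋙ K.t1) K.s1)
  (congrArg (K.q1111 ⋙ ·) (condition (π₂ K.t1 K.s1 ⋙ K.t1) K.s1).symm)
def z1111 := K.oneOf (π₂ (π₂ (π₂ K.t1 K.s1 ⋙ K.t1) K.s1 ⋙ K.t1) K.s1)
  (condition (π₂ (π₂ K.t1 K.s1 ⋙ K.t1) K.s1 ⋙ K.t1) K.s1).symm

end Domains

end CatCells

/-- Horizontal identity and composition of a bicategory object. -/
structure HComp (K : CatCells.{u₀, u₁, u₂, v₀, v₁, v₂}) where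
  /-- horizontal identity, a functor `C0 ⥤ C1` -/
  hid : K.GOne (𝟭 K.C0) (𝟭 K.C0)
  /-- horizontal composition, a functor on pairs of composable 1-cells -/
  hcomp : K.GOne (StrictPb.π₁ K.t1 K.s1 ⋙ K.s1) (StrictPb.π₂ K.t1 K.s1 ⋙ K.t1)

namespace HComp

variable {K : CatCells.{u₀, u₁, u₂, v₀, v₁, v₂}} (H : HComp K) {X : Type w} [Category.{w'} X]
  {a b c : X ⥤ K.C0}

/-- The horizontal identity of a functor to `C0`. -/
def gix (a : X ⥤ K.C0) : K.GOne a a :=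
  ⟨a ⋙ H.hid.val, congrArg (a ⋙ ·) H.hid.src, congrArg (a ⋙ ·) H.hid.tgt⟩

/-- The horizontal composite of two functors to `C1`. -/
def gmx (u : K.GOne a b) (v : K.GOne b c) : K.GOne a c :=
  ⟨StrictPb.lift u.val v.val (u.tgt.trans v.src.symm) ⋙ H.hcomp.val,
    (congrArg (StrictPb.lift u.val v.val (u.tgt.trans v.src.symm) ⋙ ·) H.hcomp.src).trans u.src,
    (congrArg (StrictPb.lift u.val v.val (u.tgt.trans v.src.symm) ⋙ ·) H.hcomp.tgt).trans v.tgt⟩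

end HComp

/-- The 1-data of a bicategory object. -/
structure OneData (K : CatCells.{u₀, u₁, u₂, v₀, v₁, v₂}) extends HComp K where
  /-- vertical identity, a functor `C1 ⥤ C2` -/
  vid : K.GTwo K.u1 K.u1
  /-- vertical composition, a functor on vertically composable pairs of 2-cells -/
  vcomp : K.GTwo (K.srcOf (StrictPb.π₁ K.t2 K.s2) rfl)
    (K.tgtOf (K.tgtOf (K.srcOf (StrictPb.π₁ K.t2 K.s2) rfl) (StrictPb.π₁ K.t2 K.s2) rfl)
      (StrictPb.π₂ K.t2 K.s2) (StrictPb.condition K.t2 K.s2).symm)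
  /-- right whisker, a functor on pairs of a 2-cell followed by a 1-cell -/
  whiskR : K.GTwo
    (toHComp.gmx (K.srcOf (StrictPb.π₁ (K.s2 ⋙ K.t1) K.s1) rfl) K.v21)
    (toHComp.gmx (K.tgtOf (K.srcOf (StrictPb.π₁ (K.s2 ⋙ K.t1) K.s1) rfl)
      (StrictPb.π₁ (K.s2 ⋙ K.t1) K.s1) rfl) K.v21)
  /-- left whisker, a functor on pairs of a 1-cell followed by a 2-cell -/
  whiskL : K.GTwo
    (toHComp.gmx K.u12 (K.srcOf (StrictPb.π₂ K.t1 (K.s2 ⋙ K.s1))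
      (StrictPb.condition K.t1 (K.s2 ⋙ K.s1)).symm))
    (toHComp.gmx K.u12 (K.tgtOf (K.srcOf (StrictPb.π₂ K.t1 (K.s2 ⋙ K.s1))
      (StrictPb.condition K.t1 (K.s2 ⋙ K.s1)).symm) (StrictPb.π₂ K.t1 (K.s2 ⋙ K.s1)) rfl))
  /-- left identity, a functor `C1 ⥤ C2` -/
  lunit : K.GTwo (toHComp.gmx (toHComp.gix K.s1) K.u1) K.u1
  /-- right identity, a functor `C1 ⥤ C2` -/
  runit : K.GTwo (toHComp.gmx K.u1 (toHComp.gix K.t1)) K.u1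
  /-- associator, a functor on triples of composable 1-cells -/
  assoc : K.GTwo (toHComp.gmx (toHComp.gmx K.u111 K.v111) K.w111)
    (toHComp.gmx K.u111 (toHComp.gmx K.v111 K.w111))

namespace OneData

variable {K : CatCells.{u₀, u₁, u₂, v₀, v₁, v₂}} (O : OneData K) {X : Type w} [Category.{w'} X]
  {a b c d : X ⥤ K.C0}

/-! The operations induced on functors to `C0`, `C1` and `C2` with a common domain. -/

def giy (u : K.GOne a b) : K.GTwo u u :=
  ⟨u.val ⋙ O.vid.val, congrArg (u.val ⋙ ·) O.vid.src, congrArg (u.val ⋙ ·) O.vid.tgt⟩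

def gmy {u v w : K.GOne a b} (x : K.GTwo u v) (y : K.GTwo v w) : K.GTwo u w :=
  ⟨StrictPb.lift x.val y.val (x.tgt.trans y.src.symm) ⋙ O.vcomp.val,
    (congrArg (StrictPb.lift x.val y.val (x.tgt.trans y.src.symm) ⋙ ·) O.vcomp.src).trans x.src,
    (congrArg (StrictPb.lift x.val y.val (x.tgt.trans y.src.symm) ⋙ ·) O.vcomp.tgt).trans y.tgt⟩

theorem gwr_aux {u u' : K.GOne a b} (x : K.GTwo u u') (v : K.GOne b c) :
    x.val ⋙ K.s2 ⋙ K.t1 = v.val ⋙ K.s1 :=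
  (congrArg (· ⋙ K.t1) x.src).trans (u.tgt.trans v.src.symm)

theorem gwl_aux (u : K.GOne a b) {v v' : K.GOne b c} (y : K.GTwo v v') :
    u.val ⋙ K.t1 = y.val ⋙ K.s2 ⋙ K.s1 :=
  u.tgt.trans ((congrArg (· ⋙ K.s1) y.src).trans v.src).symm

def gwr {u u' : K.GOne a b} (x : K.GTwo u u') (v : K.GOne b c) :
    K.GTwo (O.gmx u v) (O.gmx u' v) :=
  ⟨StrictPb.lift x.val v.val (gwr_aux x v) ⋙ O.whiskR.val,
    (congrArg (StrictPb.lift x.val v.val (gwr_aux x v) ⋙ ·) O.whiskR.src).trans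
      (congrArg (· ⋙ O.hcomp.val) (StrictPb.lift_congr x.src rfl _)),
    (congrArg (StrictPb.lift x.val v.val (gwr_aux x v) ⋙ ·) O.whiskR.tgt).trans
      (congrArg (· ⋙ O.hcomp.val) (StrictPb.lift_congr x.tgt rfl _))⟩

def gwl (u : K.GOne a b) {v v' : K.GOne b c} (y : K.GTwo v v') :
    K.GTwo (O.gmx u v) (O.gmx u v') :=
  ⟨StrictPb.lift u.val y.val (gwl_aux u y) ⋙ O.whiskL.val,
    (congrArg (StrictPb.lift u.val y.val (gwl_aux u y) ⋙ ·) O.whiskL.src).trans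
      (congrArg (· ⋙ O.hcomp.val) (StrictPb.lift_congr rfl y.src _)),
    (congrArg (StrictPb.lift u.val y.val (gwl_aux u y) ⋙ ·) O.whiskL.tgt).trans
      (congrArg (· ⋙ O.hcomp.val) (StrictPb.lift_congr rfl y.tgt _))⟩

def gil (u : K.GOne a b) : K.GTwo (O.gmx (O.gix a) u) u :=
  ⟨u.val ⋙ O.lunit.val,
    (congrArg (u.val ⋙ ·) O.lunit.src).trans (congrArg (· ⋙ O.hcomp.val)
      (StrictPb.lift_congr (congrArg (· ⋙ O.hid.val) u.src) rfl _)),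
    congrArg (u.val ⋙ ·) O.lunit.tgt⟩

def gir (u : K.GOne a b) : K.GTwo (O.gmx u (O.gix b)) u :=
  ⟨u.val ⋙ O.runit.val,
    (congrArg (u.val ⋙ ·) O.runit.src).trans (congrArg (· ⋙ O.hcomp.val)
      (StrictPb.lift_congr rfl (congrArg (· ⋙ O.hid.val) u.tgt) _)),
    congrArg (u.val ⋙ ·) O.runit.tgt⟩

/-- The functor to triples of composable 1-cells with given components. -/
def trip (u : K.GOne a b) (v : K.GOne b c) (w : K.GOne c d) : X ⥤ K.P111 :=
  StrictPb.lift (F := StrictPb.π₂ K.t1 K.s1 ⋙ K.t1) (G := K.s1)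
    (StrictPb.lift u.val v.val (u.tgt.trans v.src.symm)) w.val (v.tgt.trans w.src.symm)

def gax (u : K.GOne a b) (v : K.GOne b c) (w : K.GOne c d) :
    K.GTwo (O.gmx (O.gmx u v) w) (O.gmx u (O.gmx v w)) :=
  ⟨trip u v w ⋙ O.assoc.val, congrArg (trip u v w ⋙ ·) O.assoc.src,
    congrArg (trip u v w ⋙ ·) O.assoc.tgt⟩

end OneData

/-- The 2-data of a bicategory object: eighteen natural isomorphisms. -/
structure TwoData (K : CatCells.{u₀, u₁, u₂, v₀, v₁, v₂}) extends OneData K where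
  /-- top identity -/
  it : K.GIso (toOneData.gmy (toOneData.giy _) K.x2) K.x2
  /-- bottom identity -/
  ib : K.GIso (toOneData.gmy K.x2 (toOneData.giy _)) K.x2
  /-- vertical associator -/
  ay : K.GIso (toOneData.gmy (toOneData.gmy K.x3v K.y3v) K.r3v)
    (toOneData.gmy K.x3v (toOneData.gmy K.y3v K.r3v))
  /-- vertical identity expansion right -/
  evr : K.GIso (toOneData.gwr (toOneData.giy K.u11) K.v11)
    (toOneData.giy (toOneData.gmx K.u11 K.v11))
  /-- vertical identity expansion left -/
  evl : K.GIso (toOneData.gwl K.u11 (toOneData.giy K.v11))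
    (toOneData.giy (toOneData.gmx K.u11 K.v11))
  /-- dewhisker right -/
  dwr : K.GIso (toOneData.gwr (toOneData.gmy K.x2v1 K.y2v1) K.v2v1)
    (toOneData.gmy (toOneData.gwr K.x2v1 K.v2v1) (toOneData.gwr K.y2v1 K.v2v1))
  /-- dewhisker left -/
  dwl : K.GIso (toOneData.gwl K.u12v (toOneData.gmy K.x12v K.y12v))
    (toOneData.gmy (toOneData.gwl K.u12v K.x12v) (toOneData.gwl K.u12v K.y12v))
  /-- switch -/
  sw : K.GIso (toOneData.gmy (toOneData.gwr K.x22 _) (toOneData.gwl _ K.y22))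
    (toOneData.gmy (toOneData.gwl _ K.y22) (toOneData.gwr K.x22 _))
  /-- pass left -/
  pl : K.GIso
    (toOneData.gmy (toOneData.gwr (toOneData.gwr K.x211 K.v211) K.w211)
      (toOneData.gax _ K.v211 K.w211))
    (toOneData.gmy (toOneData.gax _ K.v211 K.w211)
      (toOneData.gwr K.x211 (toOneData.gmx K.v211 K.w211)))
  /-- pass right -/
  pr : K.GIso
    (toOneData.gmy (toOneData.gwl (toOneData.gmx K.u112 K.v112) K.x112)
      (toOneData.gax K.u112 K.v112 _))
    (toOneData.gmy (toOneData.gax K.u112 K.v112 _)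
      (toOneData.gwl K.u112 (toOneData.gwl K.v112 K.x112)))
  /-- pass middle -/
  pm : K.GIso
    (toOneData.gmy (toOneData.gwr (toOneData.gwl K.u121 K.x121) K.w121)
      (toOneData.gax K.u121 _ K.w121))
    (toOneData.gmy (toOneData.gax K.u121 _ K.w121)
      (toOneData.gwl K.u121 (toOneData.gwr K.x121 K.w121)))
  /-- pentagonator -/
  pn : K.GIso
    (toOneData.gmy (toOneData.gax (toOneData.gmx K.u1111 K.v1111) K.w1111 K.z1111)
      (toOneData.gax K.u1111 K.v1111 (toOneData.gmx K.w1111 K.z1111)))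
    (toOneData.gmy
      (toOneData.gmy (toOneData.gwr (toOneData.gax K.u1111 K.v1111 K.w1111) K.z1111)
        (toOneData.gax K.u1111 (toOneData.gmx K.v1111 K.w1111) K.z1111))
      (toOneData.gwl K.u1111 (toOneData.gax K.v1111 K.w1111 K.z1111)))
  /-- left identity pass -/
  pil : K.GIso (toOneData.gmy (toOneData.gwl (toOneData.gix _) K.x2) (toOneData.gil _))
    (toOneData.gmy (toOneData.gil _) K.x2)
  /-- right identity pass -/
  pir : K.GIso (toOneData.gmy (toOneData.gwr K.x2 (toOneData.gix _)) (toOneData.gir _))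
    (toOneData.gmy (toOneData.gir _) K.x2)
  /-- swap -/
  sp : K.GIso (toOneData.gil (toOneData.gix (𝟭 K.C0))) (toOneData.gir (toOneData.gix (𝟭 K.C0)))
  /-- left identity expansion -/
  eli : K.GIso (toOneData.gwr (toOneData.gil K.u11) K.v11)
    (toOneData.gmy (toOneData.gax (toOneData.gix _) K.u11 K.v11)
      (toOneData.gil (toOneData.gmx K.u11 K.v11)))
  /-- right identity expansion -/
  eri : K.GIso
    (toOneData.gmy (toOneData.gax K.u11 K.v11 (toOneData.gix _))
      (toOneData.gwl K.u11 (toOneData.gir K.v11)))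
    (toOneData.gir (toOneData.gmx K.u11 K.v11))
  /-- flip -/
  fp : K.GIso (toOneData.gwr (toOneData.gir K.u11) K.v11)
    (toOneData.gmy (toOneData.gax K.u11 (toOneData.gix _) K.v11)
      (toOneData.gwl K.u11 (toOneData.gil K.v11)))

theorem CellSets.Two.ind {G : CellSets.{u₀, u₁, u₂, u₃}} {a b : G.T0}
    {P : ∀ (u v : G.One a b), G.Two u v → Prop}
    (mk : ∀ (x : G.T2) (h₁ : G.s1 (G.s2 x) = a) (h₂ : G.t1 (G.s2 x) = b)
      (h₃ : G.s1 (G.t2 x) = a) (h₄ : G.t1 (G.t2 x) = b),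
      P ⟨G.s2 x, h₁, h₂⟩ ⟨G.t2 x, h₃, h₄⟩ ⟨x, rfl, rfl⟩)
    (u v : G.One a b) (x : G.Two u v) : P u v x := by
  have key : ∀ (u v : G.T1) (x : G.T2) (h₁ : G.s1 u = a) (h₂ : G.t1 u = b) (h₃ : G.s1 v = a)
      (h₄ : G.t1 v = b) (hs : G.s2 x = u) (ht : G.t2 x = v),
      P ⟨u, h₁, h₂⟩ ⟨v, h₃, h₄⟩ ⟨x, hs, ht⟩ := by
    intro u v x h₁ h₂ h₃ h₄ hs ht
    subst hs ht
    exact mk x h₁ h₂ h₃ h₄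
  exact key u.val v.val x.val u.src u.tgt v.src v.tgt x.src x.tgt

theorem CellSets.Two.ind₀ {G : CellSets.{u₀, u₁, u₂, u₃}}
    {P : ∀ (a b : G.T0) (u v : G.One a b), G.Two u v → Prop}
    (mk : ∀ (x : G.T2) (h₃ : G.s1 (G.t2 x) = G.s1 (G.s2 x)) (h₄ : G.t1 (G.t2 x) = G.t1 (G.s2 x)),
      P _ _ ⟨G.s2 x, rfl, rfl⟩ ⟨G.t2 x, h₃, h₄⟩ ⟨x, rfl, rfl⟩)
    (a b : G.T0) (u v : G.One a b) (x : G.Two u v) : P a b u v x := by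
  have key : ∀ (a b : G.T0) (x : G.T2) (h₁ : G.s1 (G.s2 x) = a) (h₂ : G.t1 (G.s2 x) = b)
      (h₃ : G.s1 (G.t2 x) = a) (h₄ : G.t1 (G.t2 x) = b),
      P a b ⟨G.s2 x, h₁, h₂⟩ ⟨G.t2 x, h₃, h₄⟩ ⟨x, rfl, rfl⟩ := by
    rintro _ _ x rfl rfl h₃ h₄
    exact mk x h₃ h₄
  exact CellSets.Two.ind (P := P a b) (key a b) u v x

/-- The cells of the underlying tricategory: the 0-, 1- and 2-cells are the objects of `C0`, `C1` and
`C2`, and the 3-cells are the morphisms of `C2` whose source and target are identity morphisms of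
`C1`. -/
abbrev CatCells.cells (K : CatCells.{u₀, u₁, u₂, v₀, v₁, v₂}) : CellSets where
  T0 := K.C0
  T1 := K.C1
  T2 := K.C2
  T3 := { c : Arrow K.C2 // IsIdentity (K.s2.map c.hom) ∧ IsIdentity (K.t2.map c.hom) }
  s1 u := K.s1.obj u
  t1 u := K.t1.obj u
  s2 x := K.s2.obj x
  t2 x := K.t2.obj x
  s3 c := c.1.left
  t3 c := c.1.right
  s1_t2 x := Functor.congr_obj K.t2_s1 x
  t1_t2 x := Functor.congr_obj K.t2_t1 x
  s2_t3 c := c.2.1.1.symm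
  t2_t3 c := c.2.2.1.symm

namespace CatCells

variable {K : CatCells.{u₀, u₁, u₂, v₀, v₁, v₂}} {a b : K.cells.T0} {u v : K.cells.One a b}

/-- The 3-cell given by a morphism of `C2`. -/
def three {x y : K.cells.Two u v} {p q : K.C2} (f : p ⟶ q) (hp : p = x.val) (hq : q = y.val)
    (hs : IsIdentity (K.s2.map f)) (ht : IsIdentity (K.t2.map f)) : K.cells.Three x y :=
  ⟨⟨Arrow.mk f, hs, ht⟩, hp, hq⟩

/-- The morphism of `C2` underlying a 3-cell. -/
def hom {x y : K.cells.Two u v} (c : K.cells.Three x y) : (c.val.1.left : K.C2) ⟶ c.val.1.right :=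
  c.val.1.hom

theorem hom_s {x y : K.cells.Two u v} (c : K.cells.Three x y) : IsIdentity (K.s2.map (hom c)) :=
  c.val.2.1

theorem hom_t {x y : K.cells.Two u v} (c : K.cells.Three x y) : IsIdentity (K.t2.map (hom c)) :=
  c.val.2.2

theorem left_s {x y : K.cells.Two u v} (c : K.cells.Three x y) : K.s2.obj c.val.1.left = u.val :=
  (congrArg K.cells.s2 c.src).trans x.src

theorem left_t {x y : K.cells.Two u v} (c : K.cells.Three x y) : K.t2.obj c.val.1.left = v.val :=
  (congrArg K.cells.t2 c.src).trans x.tgt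

theorem right_s {x y : K.cells.Two u v} (c : K.cells.Three x y) :
    K.s2.obj c.val.1.right = u.val :=
  (congrArg K.cells.s2 c.tgt).trans y.src

theorem right_t {x y : K.cells.Two u v} (c : K.cells.Three x y) :
    K.t2.obj c.val.1.right = v.val :=
  (congrArg K.cells.t2 c.tgt).trans y.tgt

end CatCells

namespace StrictPb

variable {A : Type u₀} [Category.{v₀} A] {B : Type u₁} [Category.{v₁} B]
  {C : Type u₂} [Category.{v₂} C] {F : A ⥤ C} {G : B ⥤ C}

theorem obj_congr {D : Type u₃} [Category.{w} D] (H : StrictPb F G ⥤ D) {p p' : A} {q q' : B}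
    (h : p = p') (h' : q = q') (hp : F.obj p = G.obj q) (hp' : F.obj p' = G.obj q') :
    H.obj ⟨p, q, hp⟩ = H.obj ⟨p', q', hp'⟩ := by
  subst h h'
  rfl

theorem isIdentity_lift {X : Type w} [Category.{w'} X] {D : Type u₃} [Category.{v₀} D]
    (H : X ⥤ A) (K : X ⥤ B) (h : H ⋙ F = K ⋙ G) (L : StrictPb F G ⥤ D) {x y : X} (f : x ⟶ y)
    (h₁ : IsIdentity (H.map f)) (h₂ : IsIdentity (K.map f)) :
    IsIdentity ((lift H K h ⋙ L).map f) :=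
  IsIdentity.map (StrictPb.isIdentity ((lift H K h).map f) h₁ h₂) L

/-- The morphism `(f, 𝟙)` of a strict pullback. -/
def homFst {p q : A} (f : p ⟶ q) (r : B) (hp : F.obj p = G.obj r) (hq : F.obj q = G.obj r)
    (hf : IsIdentity (F.map f)) : (⟨p, r, hp⟩ : StrictPb F G) ⟶ ⟨q, r, hq⟩ :=
  ⟨f, 𝟙 r, by
    obtain ⟨_, e⟩ := hf
    simp [e]⟩

/-- The morphism `(𝟙, f)` of a strict pullback. -/
def homSnd (r : A) {p q : B} (f : p ⟶ q) (hp : F.obj r = G.obj p) (hq : F.obj r = G.obj q)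
    (hf : IsIdentity (G.map f)) : (⟨r, p, hp⟩ : StrictPb F G) ⟶ ⟨r, q, hq⟩ :=
  ⟨𝟙 r, f, by
    obtain ⟨_, e⟩ := hf
    simp [e]⟩

end StrictPb

namespace OneData

open CatCells

variable {K : CatCells.{u₀, u₁, u₂, v₀, v₁, v₂}} (O : OneData K)

section Aux

variable {a b c d : K.cells.T0}

theorem pt11 (u : K.cells.One a b) (v : K.cells.One b c) : K.t1.obj u.val = K.s1.obj v.val :=
  u.tgt.trans v.src.symm

theorem pt2v {u v w : K.cells.One a b} (x : K.cells.Two u v) (y : K.cells.Two v w) :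
    K.t2.obj x.val = K.s2.obj y.val :=
  x.tgt.trans y.src.symm

theorem pt21 {p : K.C2} {u : K.cells.One a b} (h : K.s2.obj p = u.val) (v : K.cells.One b c) :
    (K.s2 ⋙ K.t1).obj p = K.s1.obj v.val :=
  (congrArg K.t1.obj h).trans (u.tgt.trans v.src.symm)

theorem pt12 (u : K.cells.One a b) {p : K.C2} {v : K.cells.One b c} (h : K.s2.obj p = v.val) :
    K.t1.obj u.val = (K.s2 ⋙ K.s1).obj p :=
  (u.tgt.trans v.src.symm).trans (congrArg K.s1.obj h).symm

end Aux

/-- The operations on the underlying cells: the first nine are the values of the 1-data functors on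
objects, the spatial identity and composition are those of the category `C2`, and the fins and
3-cell whiskers are `m_v (γ, id)`, `m_v (id, γ)`, `w_r (γ, id)` and `w_l (id, γ)`. -/
def ops : CellOps K.cells where
  ix a := ⟨O.hid.val.obj a, Functor.congr_obj O.hid.src a, Functor.congr_obj O.hid.tgt a⟩
  mx u v := ⟨O.hcomp.val.obj ⟨u.val, v.val, pt11 u v⟩,
    (Functor.congr_obj O.hcomp.src _).trans u.src, (Functor.congr_obj O.hcomp.tgt _).trans v.tgt⟩
  iy u := ⟨O.vid.val.obj u.val, Functor.congr_obj O.vid.src u.val,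
    Functor.congr_obj O.vid.tgt u.val⟩
  my x y := ⟨O.vcomp.val.obj ⟨x.val, y.val, pt2v x y⟩,
    (Functor.congr_obj O.vcomp.src _).trans x.src, (Functor.congr_obj O.vcomp.tgt _).trans y.tgt⟩
  wr x v := ⟨O.whiskR.val.obj ⟨x.val, v.val, pt21 x.src v⟩,
    (Functor.congr_obj O.whiskR.src _).trans (StrictPb.obj_congr _ x.src rfl _ _),
    (Functor.congr_obj O.whiskR.tgt _).trans (StrictPb.obj_congr _ x.tgt rfl _ _)⟩
  wl u _ _ y := ⟨O.whiskL.val.obj ⟨u.val, y.val, pt12 u y.src⟩,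
    (Functor.congr_obj O.whiskL.src _).trans (StrictPb.obj_congr _ rfl y.src _ _),
    (Functor.congr_obj O.whiskL.tgt _).trans (StrictPb.obj_congr _ rfl y.tgt _ _)⟩
  il u := ⟨O.lunit.val.obj u.val,
    (Functor.congr_obj O.lunit.src u.val).trans
      (StrictPb.obj_congr _ (congrArg O.hid.val.obj u.src) rfl _ _),
    Functor.congr_obj O.lunit.tgt u.val⟩
  ir u := ⟨O.runit.val.obj u.val,
    (Functor.congr_obj O.runit.src u.val).trans
      (StrictPb.obj_congr _ rfl (congrArg O.hid.val.obj u.tgt) _ _),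
    Functor.congr_obj O.runit.tgt u.val⟩
  ax u v w := ⟨O.assoc.val.obj ⟨⟨u.val, v.val, pt11 u v⟩, w.val, pt11 v w⟩,
    Functor.congr_obj O.assoc.src _, Functor.congr_obj O.assoc.tgt _⟩
  iz x := three (𝟙 (x.val : K.C2)) rfl rfl ((IsIdentity.of_id _).map _) ((IsIdentity.of_id _).map _)
  mz c d := three (hom c ≫ eqToHom (c.tgt.trans d.src.symm) ≫ hom d) c.src d.tgt
    (by
      rw [Functor.map_comp, Functor.map_comp]
      exact (hom_s c).comp (((IsIdentity.of_eqToHom _).map _).comp (hom_s d)))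
    (by
      rw [Functor.map_comp, Functor.map_comp]
      exact (hom_t c).comp (((IsIdentity.of_eqToHom _).map _).comp (hom_t d)))
  fb c y := three
    (O.vcomp.val.map (StrictPb.homFst (hom c) y.val ((left_t c).trans y.src.symm)
      ((right_t c).trans y.src.symm) (hom_t c)))
    (StrictPb.obj_congr _ c.src rfl _ _)
    (StrictPb.obj_congr _ c.tgt rfl _ _)
    (IsIdentity.of_eq O.vcomp.src (hom_s c))
    (IsIdentity.of_eq O.vcomp.tgt ((IsIdentity.of_id _).map _))
  ft x _ _ c := three
    (O.vcomp.val.map (StrictPb.homSnd x.val (hom c) (x.tgt.trans (left_s c).symm)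
      (x.tgt.trans (right_s c).symm) (hom_s c)))
    (StrictPb.obj_congr _ rfl c.src _ _)
    (StrictPb.obj_congr _ rfl c.tgt _ _)
    (IsIdentity.of_eq O.vcomp.src ((IsIdentity.of_id _).map _))
    (IsIdentity.of_eq O.vcomp.tgt (hom_t c))
  hr c v := three
    (O.whiskR.val.map (StrictPb.homFst (hom c) v.val (pt21 (left_s c) v) (pt21 (right_s c) v)
      ((hom_s c).map _)))
    (StrictPb.obj_congr _ c.src rfl _ _)
    (StrictPb.obj_congr _ c.tgt rfl _ _)
    (IsIdentity.of_eq O.whiskR.src (StrictPb.isIdentity_lift _ _ _ _ _ (hom_s c)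
      (IsIdentity.of_id _)))
    (IsIdentity.of_eq O.whiskR.tgt (StrictPb.isIdentity_lift _ _ _ _ _ (hom_t c)
      (IsIdentity.of_id _)))
  hl u _ _ _ _ c := three
    (O.whiskL.val.map (StrictPb.homSnd u.val (hom c) (pt12 u (left_s c)) (pt12 u (right_s c))
      ((hom_s c).map _)))
    (StrictPb.obj_congr _ rfl c.src _ _)
    (StrictPb.obj_congr _ rfl c.tgt _ _)
    (IsIdentity.of_eq O.whiskL.src (StrictPb.isIdentity_lift _ _ _ _ _ (IsIdentity.of_id _)
      (hom_s c)))
    (IsIdentity.of_eq O.whiskL.tgt (StrictPb.isIdentity_lift _ _ _ _ _ (IsIdentity.of_id _)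
      (hom_t c)))

end OneData

/-- The invertible 3-cell given by an isomorphism of `C2`. -/
def OneData.inv3 {K : CatCells.{u₀, u₁, u₂, v₀, v₁, v₂}} (O : OneData K) {a b : K.cells.T0}
    {u v : K.cells.One a b} {x y : K.cells.Two u v} {p q : K.C2} (e : p ≅ q)
    (hs : IsIdentity (K.s2.map e.hom)) (ht : IsIdentity (K.t2.map e.hom))
    (hp : p = x.val) (hq : q = y.val) : O.ops.Inv3 x y where
  hom := CatCells.three e.hom hp hq hs ht
  inv := CatCells.three e.inv hq hp (IsIdentity.inv (K.s2.mapIso e) hs)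
    (IsIdentity.inv (K.t2.mapIso e) ht)
  hom_inv := by
    subst hp hq
    refine CellSets.Three.ext (Subtype.ext ?_)
    refine congrArg (fun f => Arrow.mk f) ?_
    exact (congrArg (e.hom ≫ ·) (Category.id_comp e.inv)).trans e.hom_inv_id
  inv_hom := by
    subst hp hq
    refine CellSets.Three.ext (Subtype.ext ?_)
    refine congrArg (fun f => Arrow.mk f) ?_
    exact (congrArg (e.inv ≫ ·) (Category.id_comp e.hom)).trans e.inv_hom_id

/-- The data of the underlying tricategory: the operations above, together with the components
of the eighteen natural isomorphisms. -/
def TwoData.tricatData {K : CatCells.{u₀, u₁, u₂, v₀, v₁, v₂}} (D : TwoData K) :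
    TricatData K.cells where
  toCellOps := D.ops
  it := fun {_ _ u v} x =>
    D.inv3 (D.it.iso.app x.val) (D.it.src _) (D.it.tgt _)
    (by
      induction u, v, x using CellSets.Two.ind
      rfl)
    (by
      induction u, v, x using CellSets.Two.ind
      rfl)
  ib := fun {_ _ u v} x =>
    D.inv3 (D.ib.iso.app x.val) (D.ib.src _) (D.ib.tgt _)
    (by
      induction u, v, x using CellSets.Two.ind
      rfl)
    (by
      induction u, v, x using CellSets.Two.ind
      rfl)
  ay := fun x y r =>
    D.inv3 (D.ay.iso.app ⟨⟨x.val, y.val, OneData.pt2v x y⟩, r.val, OneData.pt2v y r⟩)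
      (D.ay.src _) (D.ay.tgt _) rfl rfl
  evr := fun u v =>
    D.inv3 (D.evr.iso.app ⟨u.val, v.val, OneData.pt11 u v⟩) (D.evr.src _) (D.evr.tgt _) rfl rfl
  evl := fun u v =>
    D.inv3 (D.evl.iso.app ⟨u.val, v.val, OneData.pt11 u v⟩) (D.evl.src _) (D.evl.tgt _) rfl rfl
  dwr := fun x y v =>
    D.inv3 (D.dwr.iso.app ⟨⟨x.val, y.val, OneData.pt2v x y⟩, v.val, OneData.pt21 x.src v⟩)
      (D.dwr.src _) (D.dwr.tgt _) rfl rfl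
  dwl := fun u _ _ _ x y =>
    D.inv3 (D.dwl.iso.app ⟨u.val, ⟨x.val, y.val, OneData.pt2v x y⟩, OneData.pt12 u x.src⟩)
      (D.dwl.src _) (D.dwl.tgt _) rfl rfl
  sw := fun {_ _ _ u u' v v'} x y =>
    D.inv3 (D.sw.iso.app ⟨x.val, y.val, (OneData.pt21 x.src _).trans (congrArg K.s1.obj y.src).symm⟩)
      (D.sw.src _) (D.sw.tgt _)
    (by
      induction u, u', x using CellSets.Two.ind
      induction v, v', y using CellSets.Two.ind
      rfl)
    (by
      induction u, u', x using CellSets.Two.ind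
      induction v, v', y using CellSets.Two.ind
      rfl)
  pl := fun {_ _ _ _ u u'} x v w =>
    D.inv3 (D.pl.iso.app ⟨⟨x.val, v.val, OneData.pt21 x.src v⟩, w.val, OneData.pt11 v w⟩)
      (D.pl.src _) (D.pl.tgt _)
    (by
      induction u, u', x using CellSets.Two.ind
      rfl)
    (by
      induction u, u', x using CellSets.Two.ind
      rfl)
  pr := fun {_ _ _ _} u v {w w'} x =>
    D.inv3 (D.pr.iso.app ⟨⟨u.val, v.val, OneData.pt11 u v⟩, x.val, OneData.pt12 v x.src⟩)
      (D.pr.src _) (D.pr.tgt _)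
    (by
      induction w, w', x using CellSets.Two.ind
      rfl)
    (by
      induction w, w', x using CellSets.Two.ind
      rfl)
  pm := fun {_ _ _ _} u {v v'} x w =>
    D.inv3 (D.pm.iso.app ⟨⟨u.val, x.val, OneData.pt12 u x.src⟩, w.val, OneData.pt21 x.src w⟩)
      (D.pm.src _) (D.pm.tgt _)
    (by
      induction v, v', x using CellSets.Two.ind
      rfl)
    (by
      induction v, v', x using CellSets.Two.ind
      rfl)
  pn := fun u v w z =>
    D.inv3 (D.pn.iso.app ⟨⟨⟨u.val, v.val, OneData.pt11 u v⟩, w.val, OneData.pt11 v w⟩, z.val, OneData.pt11 w z⟩)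
      (D.pn.src _) (D.pn.tgt _) rfl rfl
  pil := fun {a b u u'} x =>
    D.inv3 (D.pil.iso.app x.val) (D.pil.src _) (D.pil.tgt _)
    (by
      induction a, b, u, u', x using CellSets.Two.ind₀
      rfl)
    (by
      induction a, b, u, u', x using CellSets.Two.ind₀
      rfl)
  pir := fun {a b u u'} x =>
    D.inv3 (D.pir.iso.app x.val) (D.pir.src _) (D.pir.tgt _)
    (by
      induction a, b, u, u', x using CellSets.Two.ind₀
      rfl)
    (by
      induction a, b, u, u', x using CellSets.Two.ind₀
      rfl)
  sp := fun a =>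
    D.inv3 (D.sp.iso.app a) (D.sp.src _) (D.sp.tgt _) rfl rfl
  eli := fun u v =>
    D.inv3 (D.eli.iso.app ⟨u.val, v.val, OneData.pt11 u v⟩) (D.eli.src _) (D.eli.tgt _)
    (by
      obtain ⟨u, rfl, rfl⟩ := u
      rfl)
    (by
      obtain ⟨u, rfl, rfl⟩ := u
      rfl)
  eri := fun u v =>
    D.inv3 (D.eri.iso.app ⟨u.val, v.val, OneData.pt11 u v⟩) (D.eri.src _) (D.eri.tgt _)
    (by
      obtain ⟨v, rfl, rfl⟩ := v
      rfl)
    (by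
      obtain ⟨v, rfl, rfl⟩ := v
      rfl)
  fp := fun u v =>
    D.inv3 (D.fp.iso.app ⟨u.val, v.val, OneData.pt11 u v⟩) (D.fp.src _) (D.fp.tgt _)
    (by
      obtain ⟨u, rfl, rfl⟩ := u
      rfl)
    (by
      obtain ⟨u, rfl, rfl⟩ := u
      rfl)

namespace TwoData

variable {K : CatCells.{u₀, u₁, u₂, v₀, v₁, v₂}} (D : TwoData K) {X : Type w} [Category.{w'} X]
  {a b : X ⥤ K.C0} {U V : K.GOne a b}

/-- The value of a functor to `C1` at an object, as a 1-cell. -/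
def evOne (p : X) (U : K.GOne a b) : K.cells.One (a.obj p) (b.obj p) :=
  ⟨U.val.obj p, Functor.congr_obj U.src p, Functor.congr_obj U.tgt p⟩

/-- The value of a functor to `C2` at an object, as a 2-cell. -/
def evTwo (p : X) (x : K.GTwo U V) : K.cells.Two (evOne p U) (evOne p V) :=
  ⟨x.val.obj p, Functor.congr_obj x.src p, Functor.congr_obj x.tgt p⟩

/-- The component of a natural isomorphism at an object, as an invertible 3-cell. -/
def evIso (p : X) {x y : K.GTwo U V} (η : K.GIso x y) : D.ops.Inv3 (evTwo p x) (evTwo p y) :=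
  D.inv3 (η.iso.app p) (η.src p) (η.tgt p) rfl rfl

/-- Invertibility of a functor to `C2`: there is a functor which is a two-sided inverse up to natural
isomorphisms (sent to identities by the source and the target functor) satisfying the two triangle
identities.  A triangle identity is an equality of two natural transformations, and is stated for
all components. -/
def GInvertible (x : K.GTwo U V) : Prop :=
  ∃ (y : K.GTwo V U) (η : K.GIso (D.gmy x y) (D.giy U)) (ε : K.GIso (D.gmy y x) (D.giy V)),
    ∀ p : X, D.tricatData.Triangles (evTwo p x) (evTwo p y) (D.evIso p η) (D.evIso p ε)

end TwoData

/-- A not necessarily fibrant bicategory object in the 2-category of categories.  The axioms say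
that the composite of the edges of a polygon of natural isomorphisms between functors with
values in `C2` is an identity; as an equality of natural transformations is an equality of all
components, this is stated for the components, at every configuration of composable objects of `C0`,
`C1` and `C2` of the given shape.  The component of the natural transformation that is obtained from
a 2-datum `γ` by applying vertical composition or whiskering is `m_v (γ, id)`, `m_v (id, γ)`,
`w_r (γ, id)` or `w_l (id, γ)`. -/
structure NNFBicategoryObject extends CatCells.{u₀, u₁, u₂, v₀, v₁, v₂} where
  data : TwoData toCatCells
  lunit_invertible : data.GInvertible data.lunit
  runit_invertible : data.GInvertible data.runit
  assoc_invertible : data.GInvertible data.assoc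
  polygon : data.tricatData.PolygonAxioms

/-- A functor (to a groupoid) is a fibration if arrows lift, with given target, to invertible
arrows. -/
def IsFibration {A : Type u₀} [Category.{v₀} A] {B : Type u₁} [Category.{v₁} B] (F : A ⥤ B) :
    Prop :=
  ∀ (a' : A) (b : B) (f : b ⟶ F.obj a'), ∃ (a : A) (φ : a ≅ a') (h : F.obj a = b),
    F.map φ.hom = eqToHom h ≫ f

/-- A bicategory object in the 2-category of categories: `C0` and `C1` are groupoids, and the functors
`C1 ⥤ C0 × C0` and `C2 ⥤ C1 ×_{C0 × C0} C1` given by the source and the target are fibrations. -/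
structure BicategoryObject extends NNFBicategoryObject.{u₀, u₁, u₂, v₀, v₁, v₂} where
  groupoid₀ : ∀ {p q : C0} (f : p ⟶ q), IsIso f
  groupoid₁ : ∀ {p q : C1} (f : p ⟶ q), IsIso f
  fibration₁ : IsFibration (s1.prod' t1)
  fibration₂ : IsFibration (StrictPb.lift (F := s1.prod' t1) (G := s1.prod' t1) s2 t2
    (show s2 ⋙ s1.prod' t1 = t2 ⋙ s1.prod' t1 from
      (congrArg₂ (fun F G => Functor.prod' F G) t2_s1 t2_t1).symm))

/-- The cells of the underlying tricategory. -/
abbrev NNFBicategoryObject.cells (C : NNFBicategoryObject.{u₀, u₁, u₂, v₀, v₁, v₂}) : CellSets :=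
  C.toCatCells.cells

/-- The thirty-three maps of the underlying tricategory. -/
def NNFBicategoryObject.tricatData (C : NNFBicategoryObject.{u₀, u₁, u₂, v₀, v₁, v₂}) :
    TricatData C.cells :=
  C.data.tricatData

end InternalBicat

/-! The theorem says that a bicategory internal to categories can be read cell by cell, with the
morphisms of `C2` that are fixed by source and target as 3-cells. Its axioms have three origins.

The polygon axioms and the invertibility of the unit and associator 2-cells are equations between
natural transformations with values in `C2`. Such an equation holds when all its components agree,
and a component at a configuration of objects is exactly an equation of 3-cells. Nothing has to be
proved here beyond evaluating at the right object.

The remaining axioms concern arbitrary 3-cells. The laws of spatial composition are the category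
laws of `C2`. That fins and whiskers preserve identities and composites, and that top and bottom
fins commute, is functoriality of `m_v`, `w_r` and `w_l` on strict pullbacks: both orders of the
fins are the image of the single morphism `(f, g)`. The naturality axioms are naturality squares of
the 2-data at a morphism whose component in one variable is a 3-cell `γ` and whose other components
are identities. The functors in such a square also depend on `γ` through `s(γ)` and `t(γ)`, for
instance in `1_u` or `a_{u,v,w}`. Since `s(γ)` and `t(γ)` are identities, these factors are
identities too, and the square becomes the required equation of fins and whiskers. This is where the
restriction on 3-cells is needed.

The difficulty is in the boundaries: sources and targets agree only up to propositional equality, so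
morphisms that ought to be equal have different types. They are therefore compared as objects of the
arrow category. `StrictPb.arrow_map_ext` compares images of pullback morphisms componentwise,
`three_ind` puts boundaries in a form where most comparisons are definitional, and
`OneData.mz_naturality` turns naturality squares into equations of 3-cells. The bulk of the work is
in `TwoData.spatialAxioms`. -/

namespace InternalBicat

/-! ### Equality of morphisms as objects of the arrow category. -/

section ArrowEq

variable {A : Type u₀} [Category.{v₀} A] {B : Type u₁} [Category.{v₁} B]
  {C : Type u₂} [Category.{v₂} C]

/-- Used when a naturality square contains the image of `s(γ)` or `t(γ)` at a place where a fin or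
whisker has a literal `𝟙`. The two have different types, so they can be compared only as arrows. -/
theorem IsIdentity.mk_id_eq {X Y Z : A} {f : Y ⟶ Z} (hf : IsIdentity f) (h : X = Y) :
    Arrow.mk (𝟙 X) = Arrow.mk f := by
  obtain ⟨rfl, rfl⟩ := hf
  subst h
  rfl

theorem arrow_map_congr (F : A ⥤ B) {X Y X' Y' : A} {f : X ⟶ Y} {g : X' ⟶ Y'}
    (h : Arrow.mk f = Arrow.mk g) : Arrow.mk (F.map f) = Arrow.mk (F.map g) :=
  congrArg (fun k : Arrow A => Arrow.mk (F.map k.hom)) h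

/-- Bridges two descriptions of a constant composite factor: a fin along `y ⊙ r` carries the
identity of the composite, whereas naturality produces the composition functor applied to
identities. The law `F.map_id` is not definitional for an arbitrary functor. -/
theorem arrow_mk_map_id (F : A ⥤ B) (X : A) : Arrow.mk (𝟙 (F.obj X)) = Arrow.mk (F.map (𝟙 X)) :=
  congrArg (fun k => Arrow.mk k) (F.map_id X).symm

/-- Morphisms of a strict pullback are equal as arrows if their components are. -/
theorem StrictPb.arrow_ext {F : A ⥤ C} {G : B ⥤ C} {p q p' q' : StrictPb F G} (f : p ⟶ q)
    (g : p' ⟶ q') (h₁ : Arrow.mk f.fst = Arrow.mk g.fst)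
    (h₂ : Arrow.mk f.snd = Arrow.mk g.snd) : Arrow.mk f = Arrow.mk g := by
  obtain ⟨p₁, p₂, hp⟩ := p
  obtain ⟨q₁, q₂, hq⟩ := q
  obtain ⟨p₁', p₂', hp'⟩ := p'
  obtain ⟨q₁', q₂', hq'⟩ := q'
  obtain ⟨f₁, f₂, hf⟩ := f
  obtain ⟨g₁, g₂, hg⟩ := g
  dsimp only at f₁ f₂ g₁ g₂ h₁ h₂
  -- Eliminating the two arrow equations identifies both endpoints and both components. What remains
  -- are the compatibility conditions, which are propositions and hence agree by proof irrelevance.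
  cases h₁
  cases h₂
  rfl

theorem StrictPb.arrow_map_ext {D : Type u₃} [Category.{w} D] {F : A ⥤ C} {G : B ⥤ C}
    (H : StrictPb F G ⥤ D) {p q p' q' : StrictPb F G} {f : p ⟶ q} {g : p' ⟶ q'}
    (h₁ : Arrow.mk f.fst = Arrow.mk g.fst) (h₂ : Arrow.mk f.snd = Arrow.mk g.snd) :
    Arrow.mk (H.map f) = Arrow.mk (H.map g) :=
  arrow_map_congr H (StrictPb.arrow_ext f g h₁ h₂)

end ArrowEq

/-! ### 3-cells as morphisms of `C2`, and reduction to a standard boundary. -/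

open CatCells

variable {K : CatCells.{u₀, u₁, u₂, v₀, v₁, v₂}}

theorem CatCells.three_ext {a b : K.cells.T0} {u v : K.cells.One a b} {x y : K.cells.Two u v}
    {c d : K.cells.Three x y} (h : Arrow.mk (hom c) = Arrow.mk (hom d)) : c = d :=
  CellSets.Three.ext (Subtype.ext h)

/-- To prove a property of all 3-cells it suffices to consider 3-cells whose iterated sources are
their given boundary. -/
theorem CatCells.three_ind
    {P : ∀ (a b : K.cells.T0) (u v : K.cells.One a b) (x y : K.cells.Two u v),
      K.cells.Three x y → Prop}
    (mk : ∀ (p q : K.C2) (m : p ⟶ q) (hs : IsIdentity (K.s2.map m))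
      (ht : IsIdentity (K.t2.map m))
      (h₁ : K.s1.obj (K.t2.obj p) = K.s1.obj (K.s2.obj p))
      (h₂ : K.t1.obj (K.t2.obj p) = K.t1.obj (K.s2.obj p))
      (h₃ : K.s2.obj q = K.s2.obj p) (h₄ : K.t2.obj q = K.t2.obj p),
      P _ _ ⟨K.s2.obj p, rfl, rfl⟩ ⟨K.t2.obj p, h₁, h₂⟩ ⟨p, rfl, rfl⟩ ⟨q, h₃, h₄⟩
        ⟨⟨Arrow.mk m, hs, ht⟩, rfl, rfl⟩)
    (a b : K.cells.T0) (u v : K.cells.One a b) (x y : K.cells.Two u v)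
    (c : K.cells.Three x y) : P a b u v x y c := by
  -- All boundary cells become free variables, so each boundary equation with a variable on one side
  -- can be eliminated. The four that survive, for the ends of the target 1-cell and for the
  -- boundary of `q`, relate compound expressions once `p` determines everything else; they are
  -- handed to `mk` as hypotheses.
  have key : ∀ (a b : K.C0) (u v : K.C1) (p q x y : K.C2) (m : p ⟶ q)
      (hs : IsIdentity (K.s2.map m)) (ht : IsIdentity (K.t2.map m))
      (hx : K.s2.obj x = u) (hx' : K.t2.obj x = v) (hp : p = x) (hq : q = y)
      (hu : K.s1.obj u = a) (hu' : K.t1.obj u = b) (h₁ : K.s1.obj v = a) (h₂ : K.t1.obj v = b)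
      (h₃ : K.s2.obj y = u) (h₄ : K.t2.obj y = v),
      P a b ⟨u, hu, hu'⟩ ⟨v, h₁, h₂⟩ ⟨x, hx, hx'⟩ ⟨y, h₃, h₄⟩
        ⟨⟨Arrow.mk m, hs, ht⟩, hp, hq⟩ := by
    rintro _ _ _ _ p q _ _ m hs ht rfl rfl rfl rfl rfl rfl h₁ h₂ h₃ h₄
    exact mk p q m hs ht h₁ h₂ h₃ h₄
  exact key a b u.val v.val _ _ x.val y.val (hom c) c.val.2.1 c.val.2.2 x.src x.tgt c.src c.tgt
    u.src u.tgt v.src v.tgt y.src y.tgt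

/-- To prove a property of all composable pairs of 3-cells it suffices to consider composable pairs
of morphisms of `C2`. -/
theorem CatCells.three_ind₂
    {P : ∀ (a b : K.cells.T0) (u v : K.cells.One a b) (x y z : K.cells.Two u v),
      K.cells.Three x y → K.cells.Three y z → Prop}
    (mk : ∀ (p q r : K.C2) (m : p ⟶ q) (n : q ⟶ r) (hs : IsIdentity (K.s2.map m))
      (ht : IsIdentity (K.t2.map m)) (hs' : IsIdentity (K.s2.map n))
      (ht' : IsIdentity (K.t2.map n))
      (h₁ : K.s1.obj (K.t2.obj p) = K.s1.obj (K.s2.obj p))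
      (h₂ : K.t1.obj (K.t2.obj p) = K.t1.obj (K.s2.obj p))
      (h₃ : K.s2.obj q = K.s2.obj p) (h₄ : K.t2.obj q = K.t2.obj p)
      (h₅ : K.s2.obj r = K.s2.obj p) (h₆ : K.t2.obj r = K.t2.obj p),
      P _ _ ⟨K.s2.obj p, rfl, rfl⟩ ⟨K.t2.obj p, h₁, h₂⟩ ⟨p, rfl, rfl⟩ ⟨q, h₃, h₄⟩ ⟨r, h₅, h₆⟩
        ⟨⟨Arrow.mk m, hs, ht⟩, rfl, rfl⟩ ⟨⟨Arrow.mk n, hs', ht'⟩, rfl, rfl⟩)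
    (a b : K.cells.T0) (u v : K.cells.One a b) (x y z : K.cells.Two u v)
    (c : K.cells.Three x y) (d : K.cells.Three y z) : P a b u v x y z c d := by
  induction a, b, u, v, x, y, c using three_ind with
  | mk p q m hs ht h₁ h₂ h₃ h₄ =>
    -- The first 3-cell has already fixed the common boundary. For the second, only its own
    -- endpoints are generalized and then matched with `q` and `r`, so that `m` and `n` become
    -- composable on the nose.
    have key : ∀ (q' r' r : K.C2) (n : q' ⟶ r') (hs' : IsIdentity (K.s2.map n))
        (ht' : IsIdentity (K.t2.map n)) (hq : q' = q) (hr : r' = r)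
        (h₅ : K.s2.obj r = K.s2.obj p) (h₆ : K.t2.obj r = K.t2.obj p),
        P _ _ ⟨K.s2.obj p, rfl, rfl⟩ ⟨K.t2.obj p, h₁, h₂⟩ ⟨p, rfl, rfl⟩ ⟨q, h₃, h₄⟩
          ⟨r, h₅, h₆⟩ ⟨⟨Arrow.mk m, hs, ht⟩, rfl, rfl⟩ ⟨⟨Arrow.mk n, hs', ht'⟩, hq, hr⟩ := by
      rintro _ _ r n hs' ht' rfl rfl h₅ h₆
      exact mk p _ _ m n hs ht hs' ht' h₁ h₂ h₃ h₄ h₅ h₆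
    exact key _ _ z.val (hom d) d.val.2.1 d.val.2.2 d.src d.tgt z.src z.tgt

/-- A gentler alternative to `three_ind`: only the endpoints of the morphism are corrected, and the
0-, 1- and 2-cells of the boundary stay arbitrary. It remains applicable when several 3-cells share
part of their boundary. -/
theorem CatCells.exists_hom {a b : K.cells.T0} {u v : K.cells.One a b} {x y : K.cells.Two u v}
    (c : K.cells.Three x y) :
    ∃ m : x.val ⟶ y.val, Arrow.mk (hom c) = Arrow.mk m ∧ IsIdentity (K.s2.map m) ∧
      IsIdentity (K.t2.map m) := by
  induction a, b, u, v, x, y, c using three_ind with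
  | mk p q m hs ht => exact ⟨m, rfl, hs, ht⟩

/-! ### Spatial composites computed by composition in `C2`. -/

namespace OneData

variable (O : OneData K) {a b : K.cells.T0} {u v : K.cells.One a b}

/-- Removes the `eqToHom` from the definition of spatial composition: once both factors are
represented by morphisms that meet at the same object `q`, that transport is an identity. -/
theorem hom_mz {x y z : K.cells.Two u v} {c : K.cells.Three x y} {d : K.cells.Three y z}
    {p q r : K.C2} {f : p ⟶ q} {g : q ⟶ r} (hc : Arrow.mk (hom c) = Arrow.mk f)
    (hd : Arrow.mk (hom d) = Arrow.mk g) : Arrow.mk (hom (O.ops.mz c d)) = Arrow.mk (f ≫ g) := by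
  obtain ⟨⟨c, hc₁⟩, hc₂, hc₃⟩ := c
  obtain ⟨⟨d, hd₁⟩, hd₂, hd₃⟩ := d
  obtain rfl : c = Arrow.mk f := hc
  obtain rfl : d = Arrow.mk g := hd
  -- The middle `eqToHom` now goes from `q` to itself and is definitionally `𝟙 q`.
  exact congrArg (fun k => Arrow.mk (f ≫ k)) (Category.id_comp g)

/-- A commutative square in `C2` gives an equality of spatial composites. -/
theorem mz_eq_mz {x y y' z : K.cells.Two u v} {c : K.cells.Three x y} {d : K.cells.Three y z}
    {c' : K.cells.Three x y'} {d' : K.cells.Three y' z} {p q q' r : K.C2} {f : p ⟶ q} {g : q ⟶ r}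
    {f' : p ⟶ q'} {g' : q' ⟶ r} (h : f ≫ g = f' ≫ g')
    (hc : Arrow.mk (hom c) = Arrow.mk f) (hd : Arrow.mk (hom d) = Arrow.mk g)
    (hc' : Arrow.mk (hom c') = Arrow.mk f') (hd' : Arrow.mk (hom d') = Arrow.mk g') :
    O.ops.mz c d = O.ops.mz c' d' :=
  three_ext ((O.hom_mz hc hd).trans
    ((congrArg (fun k => Arrow.mk k) h).trans (O.hom_mz hc' hd').symm))

/-- A commutative triangle in `C2` gives an expression of a 3-cell as a spatial composite. -/
theorem eq_mz {x y z : K.cells.Two u v} {e : K.cells.Three x z} {c : K.cells.Three x y}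
    {d : K.cells.Three y z} {p q r : K.C2} {k : p ⟶ r} {f : p ⟶ q} {g : q ⟶ r} (h : k = f ≫ g)
    (he : Arrow.mk (hom e) = Arrow.mk k) (hc : Arrow.mk (hom c) = Arrow.mk f)
    (hd : Arrow.mk (hom d) = Arrow.mk g) : e = O.ops.mz c d :=
  three_ext (he.trans ((congrArg (fun k => Arrow.mk k) h).trans (O.hom_mz hc hd).symm))

/-- The naturality square of a natural isomorphism between functors to `C2`, in terms of 3-cells. -/
theorem mz_naturality {X : Type w} [Category.{w'} X] {F G : X ⥤ K.C2} (η : F ≅ G) {p q : X}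
    (φ : p ⟶ q) {x y y' z : K.cells.Two u v} {c : K.cells.Three x y} {d : K.cells.Three y z}
    {c' : K.cells.Three x y'} {d' : K.cells.Three y' z}
    (hc : Arrow.mk (hom c) = Arrow.mk (F.map φ))
    (hd : Arrow.mk (hom d) = Arrow.mk (η.hom.app q))
    (hc' : Arrow.mk (hom c') = Arrow.mk (η.hom.app p))
    (hd' : Arrow.mk (hom d') = Arrow.mk (G.map φ)) :
    O.ops.mz c d = O.ops.mz c' d' :=
  -- The four hypotheses identify the sides of the naturality square with the given 3-cells. In
  -- applications the two components of `η` match by `rfl`, so only the images of `φ` need an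
  -- argument.
  O.mz_eq_mz (η.hom.naturality φ) hc hd hc' hd'

end OneData

/-! ### The axioms for spatial composition, fins and 3-cell whiskers. -/

/-- Category laws, functoriality and naturality, as the case may be. In each naturality axiom the
morphism `φ` passed to `mz_naturality` moves exactly one 2-cell variable. The rest of the term
checks the factors of the square one by one: `rfl` for those containing the 3-cell directly,
`mk_id_eq` for those depending only on its source or target, and `arrow_mk_map_id` for composite
factors that do not move. -/
theorem TwoData.spatialAxioms (D : TwoData K) : D.tricatData.SpatialAxioms where
  ax27 {a b u v x y} f := by
    induction a, b, u, v, x, y, f using three_ind with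
    | mk p q m => exact (D.eq_mz (Category.id_comp m).symm rfl rfl rfl).symm
  ax27z {a b u v x y} f := by
    induction a, b, u, v, x, y, f using three_ind with
    | mk p q m => exact (D.eq_mz (Category.comp_id m).symm rfl rfl rfl).symm
  ax28 f g h := by
    obtain ⟨_, hf, -⟩ := exists_hom f
    obtain ⟨_, hg, -⟩ := exists_hom g
    obtain ⟨_, hh, -⟩ := exists_hom h
    exact D.mz_eq_mz (Category.assoc _ _ _) (D.hom_mz hf hg) hh hf (D.hom_mz hg hh)
  -- The pair of two identities is definitionally the identity of the strict pullback, so `map_id`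
  -- applies directly.
  ax29 x y := three_ext (congrArg (fun k => Arrow.mk k) (D.vcomp.val.map_id _))
  ax29y x y := three_ext (congrArg (fun k => Arrow.mk k) (D.vcomp.val.map_id _))
  ax30 {a b u v x x'} f := by
    induction a, b, u, v, x, x', f using three_ind with
    | mk p q m hs ht =>
      -- Naturality gives `m_v(1_{s(m)}, m)`. Its first entry is an identity because `s(m)` is,
      -- which is what `hs` provides. For the bottom identity the entry is `1_{t(m)}`, and `ht`
      -- takes over.
      exact D.mz_naturality D.it.iso m
        (StrictPb.arrow_map_ext _ ((hs.map _).mk_id_eq rfl) rfl) rfl rfl rfl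
  ax30y {a b u v x x'} f := by
    induction a, b, u, v, x, x', f using three_ind with
    | mk p q m hs ht =>
      exact D.mz_naturality D.ib.iso m
        (StrictPb.arrow_map_ext _ rfl ((ht.map _).mk_id_eq rfl)) rfl rfl rfl
  ax31 {a b u v w x x' x''} f g y := by
    induction a, b, u, v, x, x', x'', f, g using three_ind₂ with
    | mk p q r m n hs ht hs' ht' h₁ h₂ h₃ h₄ h₅ h₆ =>
      exact D.eq_mz (D.vcomp.val.map_comp
        (StrictPb.homFst m y.val y.src.symm (h₄.trans y.src.symm) ht)
        (StrictPb.homFst n y.val (h₄.trans y.src.symm) (h₆.trans y.src.symm) ht'))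
        -- The fin on a composite carries a single `𝟙` in the fixed entry, while composing two fins
        -- gives `𝟙 ≫ 𝟙`; the moving entry is handled by `hom_mz`.
        (StrictPb.arrow_map_ext _ (D.hom_mz rfl rfl)
          (congrArg (fun k => Arrow.mk k) (Category.comp_id _).symm)) rfl rfl
  ax31y {a b u v w} x {y y' y''} f g := by
    induction a, b, v, w, y, y', y'', f, g using three_ind₂ with
    | mk p q r m n hs ht hs' ht' h₁ h₂ h₃ h₄ h₅ h₆ =>
      exact D.eq_mz (D.vcomp.val.map_comp
        (StrictPb.homSnd x.val m x.tgt (x.tgt.trans h₃.symm) hs)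
        (StrictPb.homSnd x.val n (x.tgt.trans h₃.symm) (x.tgt.trans h₅.symm) hs'))
        (StrictPb.arrow_map_ext _ (congrArg (fun k => Arrow.mk k) (Category.comp_id _).symm)
          (D.hom_mz rfl rfl)) rfl rfl
  ax32 {a b u v w x x' y y'} f g := by
    -- The 3-cells share the 1-cell `v`, which cannot be both the literal target from `f` and the
    -- literal source from `g`. So `three_ind` is not used, and only the endpoints are normalized.
    obtain ⟨m, hm, -, ht⟩ := exists_hom f
    obtain ⟨n, hn, hs, -⟩ := exists_hom g
    refine D.mz_eq_mz (f := D.vcomp.val.map (StrictPb.homSnd x.val n (OneData.pt2v x y)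
        (OneData.pt2v x y') hs))
      (g := D.vcomp.val.map (StrictPb.homFst m y'.val (OneData.pt2v x y') (OneData.pt2v x' y') ht))
      (f' := D.vcomp.val.map (StrictPb.homFst m y.val (OneData.pt2v x y) (OneData.pt2v x' y) ht))
      (g' := D.vcomp.val.map (StrictPb.homSnd x'.val n (OneData.pt2v x' y) (OneData.pt2v x' y') hs))
      ?_ (StrictPb.arrow_map_ext _ rfl hn) (StrictPb.arrow_map_ext _ hm rfl)
      (StrictPb.arrow_map_ext _ hm rfl) (StrictPb.arrow_map_ext _ rfl hn)
    -- Both sides become the image under `m_v` of one pullback morphism, factored as `(𝟙, n)` then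
    -- `(m, 𝟙)` or in the opposite order; both products are `(m, n)`.
    rw [← Functor.map_comp, ← Functor.map_comp]
    exact congrArg _ (StrictPb.Hom.ext ((Category.id_comp m).trans (Category.comp_id m).symm)
      ((Category.comp_id n).trans (Category.id_comp n).symm))
  ax33 {a b u v w z x x'} f y r := by
    induction a, b, u, v, x, x', f using three_ind with
    | mk p q m hs ht h₁ h₂ h₃ h₄ =>
      exact D.mz_naturality D.ay.iso (StrictPb.homFst
        (StrictPb.homFst m y.val y.src.symm (h₄.trans y.src.symm) ht) r.val
          (OneData.pt2v y r) (OneData.pt2v y r) ((IsIdentity.of_id _).map _)) rfl rfl rfl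
        -- After reassociation the fixed factor is `y ⊙ r`: naturality yields `m_v(𝟙, 𝟙)` there, the
        -- fin a plain `𝟙`.
        (StrictPb.arrow_map_ext _ rfl (arrow_mk_map_id _ _))
  ax33y {a b u v w z} x y {r r'} f := by
    induction a, b, w, z, r, r', f using three_ind with
    | mk p q m hs ht h₁ h₂ h₃ h₄ =>
      exact D.mz_naturality D.ay.iso (StrictPb.homSnd ⟨x.val, y.val, OneData.pt2v x y⟩ m
          y.tgt (y.tgt.trans h₃.symm) hs)
        (StrictPb.arrow_map_ext _ (arrow_mk_map_id _ _) rfl) rfl rfl rfl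
  ax34 {a b u v w z} x {y y'} f r := by
    induction a, b, v, w, y, y', f using three_ind with
    | mk p q m hs ht h₁ h₂ h₃ h₄ =>
      -- When the middle variable moves, neither bracketing has a composite factor that stays fixed,
      -- so all four sides agree definitionally.
      exact D.mz_naturality D.ay.iso (StrictPb.homFst
        (StrictPb.homSnd x.val m x.tgt (x.tgt.trans h₃.symm) hs) r.val
          r.src.symm (h₄.trans r.src.symm) ht) rfl rfl rfl rfl
  ax35 x v := three_ext (congrArg (fun k => Arrow.mk k) (D.whiskR.val.map_id _))
  ax35x v _ _ x := three_ext (congrArg (fun k => Arrow.mk k) (D.whiskL.val.map_id _))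
  ax36 {a b u u' x x'} f := by
    induction a, b, u, u', x, x', f using three_ind with
    | mk p q m hs ht =>
      -- Three factors depend on `m` only through its boundary: the identity 1-cell at the end of
      -- `s(m)`, the 2-cell `r` at `t(m)` on one side of the square, and `r` at `s(m)` on the other.
      exact D.mz_naturality D.pir.iso m
        (StrictPb.arrow_map_ext _
          (StrictPb.arrow_map_ext _ rfl (((hs.map _).map _).mk_id_eq rfl))
          ((ht.map _).mk_id_eq rfl)) rfl rfl
        (StrictPb.arrow_map_ext _ ((hs.map _).mk_id_eq rfl) rfl)
  ax36x {a b u u' x x'} f := by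
    induction a, b, u, u', x, x', f using three_ind with
    | mk p q m hs ht =>
      exact D.mz_naturality D.pil.iso m
        (StrictPb.arrow_map_ext _
          (StrictPb.arrow_map_ext _ (((hs.map _).map _).mk_id_eq rfl) rfl)
          ((ht.map _).mk_id_eq rfl)) rfl rfl
        (StrictPb.arrow_map_ext _ ((hs.map _).mk_id_eq rfl) rfl)
  ax37 {a b c u u' v v' x x'} f y := by
    induction a, b, u, u', x, x', f using three_ind with
    | mk p q m hs ht h₁ h₂ h₃ h₄ =>
      -- In the switch isomorphism the 1-cells beside `x` are the source and target of `y` by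
      -- construction. The induction makes `v` and `v'` literally these.
      induction v, v', y using CellSets.Two.ind with
      | mk y k₁ k₂ k₃ k₄ =>
        exact D.mz_naturality D.sw.iso (StrictPb.homFst m y k₁.symm
            ((congrArg K.t1.obj h₃).trans k₁.symm) (hs.map _))
          (StrictPb.arrow_map_ext _
            (StrictPb.arrow_map_ext _ rfl (arrow_mk_map_id _ _))
            -- The factor `u' ◃ y` sees only `t(m)`, and the factor `u ◃ y` on the other side only
            -- `s(m)`. Hence both conditions on a 3-cell are used, one on each side of the square.
            (((StrictPb.isIdentity _ ht (IsIdentity.of_id _)).map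
              D.whiskL.val).mk_id_eq rfl))
          rfl rfl
          (StrictPb.arrow_map_ext _
            (((StrictPb.isIdentity _ hs (IsIdentity.of_id _)).map
              D.whiskL.val).mk_id_eq rfl)
            (StrictPb.arrow_map_ext _ rfl (arrow_mk_map_id _ _)))
  ax37x {a b c u u' v v'} x {y y'} f := by
    induction b, c, v, v', y, y', f using three_ind with
    | mk p q m hs ht h₁ h₂ h₃ h₄ =>
      induction u, u', x using CellSets.Two.ind with
      | mk x k₁ k₂ k₃ k₄ =>
        exact D.mz_naturality D.sw.iso (StrictPb.homSnd x m k₂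
            (k₂.trans (congrArg K.s1.obj h₃).symm) (hs.map _))
          (StrictPb.arrow_map_ext _
            (((StrictPb.isIdentity _ (IsIdentity.of_id _) hs).map
              D.whiskR.val).mk_id_eq rfl)
            (StrictPb.arrow_map_ext _ (arrow_mk_map_id _ _) rfl))
          rfl rfl
          (StrictPb.arrow_map_ext _
            (StrictPb.arrow_map_ext _ (arrow_mk_map_id _ _) rfl)
            (((StrictPb.isIdentity _ (IsIdentity.of_id _) ht).map
              D.whiskR.val).mk_id_eq rfl))
  ax38 {a b c u u' x x' x''} f g v := by
    induction a, b, u, u', x, x', x'', f, g using three_ind₂ with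
    | mk p q r m n hs ht hs' ht' h₁ h₂ h₃ h₄ h₅ h₆ =>
      exact D.eq_mz (D.whiskR.val.map_comp
        (StrictPb.homFst m v.val v.src.symm ((congrArg K.t1.obj h₃).trans v.src.symm) (hs.map _))
        (StrictPb.homFst n v.val ((congrArg K.t1.obj h₃).trans v.src.symm)
          ((congrArg K.t1.obj h₅).trans v.src.symm) (hs'.map _)))
        (StrictPb.arrow_map_ext _ (D.hom_mz rfl rfl)
          (congrArg (fun k => Arrow.mk k) (Category.comp_id _).symm)) rfl rfl
  ax38x {a b c} v {u u' x x' x''} f g := by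
    induction b, c, u, u', x, x', x'', f, g using three_ind₂ with
    | mk p q r m n hs ht hs' ht' h₁ h₂ h₃ h₄ h₅ h₆ =>
      exact D.eq_mz (D.whiskL.val.map_comp
        (StrictPb.homSnd v.val m v.tgt (v.tgt.trans (congrArg K.s1.obj h₃).symm) (hs.map _))
        (StrictPb.homSnd v.val n (v.tgt.trans (congrArg K.s1.obj h₃).symm)
          (v.tgt.trans (congrArg K.s1.obj h₅).symm) (hs'.map _)))
        (StrictPb.arrow_map_ext _ (congrArg (fun k => Arrow.mk k) (Category.comp_id _).symm)
          (D.hom_mz rfl rfl)) rfl rfl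
  ax39 {a b c u u' u'' x x'} f y v := by
    induction a, b, u, u', x, x', f using three_ind with
    | mk p q m hs ht h₁ h₂ h₃ h₄ =>
      exact D.mz_naturality D.dwr.iso (StrictPb.homFst
        (StrictPb.homFst m y.val y.src.symm (h₄.trans y.src.symm) ht) v.val
          v.src.symm ((congrArg K.t1.obj h₃).trans v.src.symm) (hs.map _)) rfl rfl rfl
        (StrictPb.arrow_map_ext _ rfl (arrow_mk_map_id _ _))
  ax39x {a b c} v {u u' u'' x x'} f y := by
    induction b, c, u, u', x, x', f using three_ind with
    | mk p q m hs ht h₁ h₂ h₃ h₄ =>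
      exact D.mz_naturality D.dwl.iso (StrictPb.homSnd v.val
        (StrictPb.homFst m y.val y.src.symm (h₄.trans y.src.symm) ht)
          v.tgt (v.tgt.trans (congrArg K.s1.obj h₃).symm) (hs.map _)) rfl rfl rfl
        (StrictPb.arrow_map_ext _ rfl (arrow_mk_map_id _ _))
  ax39y {a b c u u' u''} x {y y'} f v := by
    obtain ⟨m, hm, hs, -⟩ := exists_hom f
    -- Here `f` is represented by `m` only up to equality of arrows, so its occurrences are compared
    -- through `hm` instead of `rfl`.
    exact D.mz_naturality D.dwr.iso (StrictPb.homFst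
      (StrictPb.homSnd x.val m (OneData.pt2v x y) (OneData.pt2v x y') hs) v.val
        (OneData.pt21 x.src v) (OneData.pt21 x.src v) ((IsIdentity.of_id _).map (K.s2 ⋙ K.t1)))
      (StrictPb.arrow_map_ext _ (StrictPb.arrow_map_ext _ rfl hm) rfl) rfl rfl
      (StrictPb.arrow_map_ext _ (arrow_mk_map_id _ _) (StrictPb.arrow_map_ext _ hm rfl))
  ax39xy {a b c} v {u u' u''} x {y y'} f := by
    obtain ⟨m, hm, hs, -⟩ := exists_hom f
    exact D.mz_naturality D.dwl.iso (StrictPb.homSnd v.val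
      (StrictPb.homSnd x.val m (OneData.pt2v x y) (OneData.pt2v x y') hs)
        (OneData.pt12 v x.src) (OneData.pt12 v x.src) ((IsIdentity.of_id _).map (K.s2 ⋙ K.s1)))
      (StrictPb.arrow_map_ext _ rfl (StrictPb.arrow_map_ext _ rfl hm)) rfl rfl
      (StrictPb.arrow_map_ext _ (arrow_mk_map_id _ _) (StrictPb.arrow_map_ext _ rfl hm))
  ax40 {a b c d u u' x x'} f v w := by
    induction a, b, u, u', x, x', f using three_ind with
    | mk p q m hs ht h₁ h₂ h₃ h₄ =>
      exact D.mz_naturality D.pl.iso (StrictPb.homFst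
        (StrictPb.homFst m v.val v.src.symm ((congrArg K.t1.obj h₃).trans v.src.symm) (hs.map _))
          w.val (OneData.pt11 v w) (OneData.pt11 v w) ((IsIdentity.of_id _).map _))
        -- The associator is applied to the triple `(t(m), 𝟙, 𝟙)`, and to `(s(m), 𝟙, 𝟙)` on the
        -- other side. A pullback morphism with identity components is an identity, so its image
        -- under the associator functor is one as well.
        (StrictPb.arrow_map_ext _ rfl (((StrictPb.isIdentity _ (StrictPb.isIdentity _ ht
          (IsIdentity.of_id _)) (IsIdentity.of_id _)).map D.assoc.val).mk_id_eq rfl)) rfl rfl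
        (StrictPb.arrow_map_ext _ (((StrictPb.isIdentity _ (StrictPb.isIdentity _ hs
          (IsIdentity.of_id _)) (IsIdentity.of_id _)).map D.assoc.val).mk_id_eq rfl)
          (StrictPb.arrow_map_ext _ rfl (arrow_mk_map_id _ _)))
  ax40x {a b c d} u v {w w' x x'} f := by
    induction c, d, w, w', x, x', f using three_ind with
    | mk p q m hs ht h₁ h₂ h₃ h₄ =>
      exact D.mz_naturality D.pr.iso (StrictPb.homSnd ⟨u.val, v.val, OneData.pt11 u v⟩ m v.tgt
          (v.tgt.trans (congrArg K.s1.obj h₃).symm) (hs.map _))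
        (StrictPb.arrow_map_ext _ (StrictPb.arrow_map_ext _ (arrow_mk_map_id _ _) rfl)
          (((StrictPb.isIdentity _ (IsIdentity.of_id _) ht).map D.assoc.val).mk_id_eq rfl)) rfl rfl
        (StrictPb.arrow_map_ext _
          (((StrictPb.isIdentity _ (IsIdentity.of_id _) hs).map D.assoc.val).mk_id_eq rfl) rfl)
  ax41 {a b c d} u {v v' x x'} f w := by
    induction b, c, v, v', x, x', f using three_ind with
    | mk p q m hs ht h₁ h₂ h₃ h₄ =>
      exact D.mz_naturality D.pm.iso (StrictPb.homFst
        (StrictPb.homSnd u.val m u.tgt (u.tgt.trans (congrArg K.s1.obj h₃).symm) (hs.map _))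
          w.val w.src.symm ((congrArg K.t1.obj h₃).trans w.src.symm) (hs.map _))
        (StrictPb.arrow_map_ext _ rfl (((StrictPb.isIdentity _ (StrictPb.isIdentity _
          (IsIdentity.of_id _) ht) (IsIdentity.of_id _)).map D.assoc.val).mk_id_eq rfl)) rfl rfl
        (StrictPb.arrow_map_ext _ (((StrictPb.isIdentity _ (StrictPb.isIdentity _
          (IsIdentity.of_id _) hs) (IsIdentity.of_id _)).map D.assoc.val).mk_id_eq rfl) rfl)

end InternalBicat

/-! ### Assembling the tricategory. -/

theorem mainTheorem2 (C : InternalBicat.NNFBicategoryObject.{u₀, u₁, u₂, v₀, v₁, v₂}) :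
    ∃ T : InternalBicat.Tricategory C.cells, T.toTricatData = C.tricatData := by
  refine ⟨{ C.tricatData with
    il_invertible := ?_
    ir_invertible := ?_
    ax_invertible := ?_
    polygon := C.polygon
    spatial := C.data.spatialAxioms }, rfl⟩
  -- With the ends of `u` made literal, evaluating the functors at the object `u` gives the 2-cell
  -- `l_u` and its composites definitionally. The inverse and its triangle identities can thus be
  -- evaluated at `u`.
  · rintro _ _ ⟨u, rfl, rfl⟩
    obtain ⟨y, η, ε, h⟩ := C.lunit_invertible
    exact ⟨InternalBicat.TwoData.evTwo u y, C.data.evIso u η, C.data.evIso u ε, h u⟩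
  · rintro _ _ ⟨u, rfl, rfl⟩
    obtain ⟨y, η, ε, h⟩ := C.runit_invertible
    exact ⟨InternalBicat.TwoData.evTwo u y, C.data.evIso u η, C.data.evIso u ε, h u⟩
  · rintro _ _ _ _ ⟨u, rfl, rfl⟩ ⟨v, hv, rfl⟩ ⟨w, hw, rfl⟩
    obtain ⟨y, η, ε, h⟩ := C.assoc_invertible
    -- The composable triple as an object of the iterated pullback; the matching conditions `hv` and
    -- `hw` cannot be eliminated and become part of `p`.
    let p : C.P111 := ⟨⟨u, v, hv.symm⟩, w, hw.symm⟩
    exact ⟨InternalBicat.TwoData.evTwo p y, C.data.evIso p η, C.data.evIso p ε, h p⟩
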